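/- Let $\mathbb K$ be an algebraically closed field of characteristic zero. A trinomial is a polynomial of the form $$f=\sum_{i=0}^{2}\ \prod_{j=1}^{n_i}T_{ij}^{l_{ij}}\in\mathbb K[T_{ij};\ i=0,1,2,\ j=1,\dots,n_i],$$ where $n_0,n_1,n_2$ and all $l_{ij}$ are positive integers. The trinomial hypersurface $\{f=0\}$ is the zero set of $f$ in the affine space $\mathbb K^{n}$, $n=n_0+n_1+n_2$. An affine variety is rigid if every regular action of the additive group $(\mathbb K,+)$ on it is trivial. Let $f=\sum_{i=0}^2\prod_{j=1}^{n_i}T_{ij}^{l_{ij}}$ and $g=\sum_{i=0}^2\prod_{j=1}^{m_i}S_{ij}^{l'_{ij}}$ be trinomials, possibly with different numbers of variables, and suppose that the hypersurface $\{f=0\}$ is rigid. Then the affine varieties $\{f=0\}$ and $\{g=0\}$ are isomorphic if and only if $g$ is obtained from $f$ by a permutation of the variables, that is, if and only if there is a bijection from the set of variables $\{T_{ij}\}$ to the set of variables $\{S_{ij}\}$ such that substituting the variables according to this bijection turns $f$ into $g$. -/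

import Mathlib

/-- The trinomial `T_0^{l_0} + T_1^{l_1} + T_2^{l_2}` in the variables `T_{ij}`, `i = 0, 1, 2`,
`j = 1, …, n_i`, where `T_i^{l_i} = ∏ j, T_{ij}^{l_{ij}}`. -/
noncomputable def trinomial (K : Type*) [CommSemiring K] {n : Fin 3 → ℕ}
    (l : (i : Fin 3) → Fin (n i) → ℕ) : MvPolynomial ((i : Fin 3) × Fin (n i)) K :=
  ∑ i : Fin 3, ∏ j : Fin (n i), MvPolynomial.X ⟨i, j⟩ ^ l i j

/-- The zero set `{f = 0}` in the affine space with coordinates indexed by `σ`. -/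
def hypersurface {K σ : Type*} [CommSemiring K] (f : MvPolynomial σ K) : Set (σ → K) :=
  {x | MvPolynomial.eval x f = 0}

/-- A map between subsets of affine spaces is regular if it is the restriction of a
polynomial map of the ambient affine spaces. -/
def IsRegularMap {K σ τ : Type*} [CommSemiring K] {V : Set (σ → K)} {W : Set (τ → K)}
    (φ : V → W) : Prop :=
  ∃ P : τ → MvPolynomial σ K, ∀ (x : V) (j : τ),
    (φ x : τ → K) j = MvPolynomial.eval (x : σ → K) (P j)

/-- Two closed subvarieties of affine spaces are isomorphic if there is a bijection between
them which is regular in both directions. -/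
def AreIsomorphic {K σ τ : Type*} [CommSemiring K] (V : Set (σ → K)) (W : Set (τ → K)) : Prop :=
  ∃ φ : V ≃ W, IsRegularMap φ ∧ IsRegularMap φ.symm

/-- An action of the additive group of `K` on a closed subset `V` of an affine space is regular
if the map `(t, x) ↦ t +ᵥ x` from `K × V` to `V` is given by polynomials in `t`
(the variable `none`) and the coordinates of `x` (the variables `some i`). -/
def IsRegularGaAction {K σ : Type*} [CommRing K] (V : Set (σ → K)) [AddAction K V] : Prop :=
  ∃ P : σ → MvPolynomial (Option σ) K, ∀ (t : K) (x : V) (j : σ),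
    ((t +ᵥ x : V) : σ → K) j =
      MvPolynomial.eval (fun o : Option σ => o.elim t (x : σ → K)) (P j)

/-- A closed subvariety of an affine space is rigid if every regular action of the additive
group `(K, +)` on it is trivial. -/
def IsRigidVariety {K σ : Type*} [CommRing K] (V : Set (σ → K)) : Prop :=
  ∀ [AddAction K V], IsRegularGaAction V → ∀ (t : K) (x : V), t +ᵥ x = x

/-! A trinomial is squarefree, so by the Nullstellensatz an isomorphism of hypersurfaces lifts to
homomorphisms of polynomial rings that are mutually inverse modulo `f` and `g`
(`nonempty_hypersurfaceEquiv`). Weights for which the three monomials of `g` are equally heavy give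
diagonal derivations: the Lie algebra of the torus acting on `{g = 0}`. Transferred to `{f = 0}`
they remain diagonalizable modulo `f`.

Rigidity forces such a derivation to be diagonal, modulo `f`, in the given coordinates
(`exists_diagonal_of_isRigidVariety`). For a grading compatible with `f`, its extreme component of
nonzero degree is locally nilpotent modulo `f`; its exponentials form an additive group action, so
it vanishes modulo `f` (`IsRigidVariety.dvd_derivation`, `dvd_nonzero_component`). What survives has
degree zero for all gradings at once, and `universalWeight_component_support` shows that it is
diagonal. The exceptional exponents there are excluded by explicit locally nilpotent derivations
(`two_le_of_isRigidVariety`, `not_two_singletons_of_isRigidVariety`).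

Hence the image of each variable of `g` is an eigenvector modulo `f`. Its constant term is zero, and
the linear parts of the two homomorphisms are inverse matrices. A nonzero term in the expansion of
the determinant matches the variables compatibly with the weights
(`HypersurfaceEquiv.exists_weight`). The weights determine the groups up to permutation and the
exponents up to a common factor (`exists_perm_of_weights`, `proportional_of_weights`); the
multiplicity at the origin fixes that factor (`HypersurfaceEquiv.mem_idealOfVars_pow`). -/

open MvPolynomial
set_option linter.unusedSectionVars false

/-! ### Exponentials of locally nilpotent derivations and rigidity -/

section LocallyNilpotent

variable {K σ : Type*} [Field K] [CharZero K]

/-- The Taylor series `∑ n, eval x (D^n p) / n! t^n` of a polynomial along a derivation. -/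
noncomputable def expSeriesFun (D : Derivation K (MvPolynomial σ K) (MvPolynomial σ K))
    (x : σ → K) (p : MvPolynomial σ K) : PowerSeries K :=
  PowerSeries.mk fun n => eval x (D^[n] p) / (n.factorial : K)

theorem derivative_expSeriesFun (D : Derivation K (MvPolynomial σ K) (MvPolynomial σ K))
    (x : σ → K) (p : MvPolynomial σ K) :
    PowerSeries.derivative K (expSeriesFun D x p) = expSeriesFun D x (D p) := by
  ext n
  rw [PowerSeries.coeff_derivative]
  simp only [expSeriesFun, PowerSeries.coeff_mk, Function.iterate_succ_apply, Nat.factorial_succ]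
  have h1 : (n.factorial : K) ≠ 0 := by exact_mod_cast n.factorial_ne_zero
  have h2 : (n + 1 : K) ≠ 0 := by exact_mod_cast n.succ_ne_zero
  push_cast
  field_simp

theorem expSeriesFun_add (D : Derivation K (MvPolynomial σ K) (MvPolynomial σ K))
    (x : σ → K) (p q : MvPolynomial σ K) :
    expSeriesFun D x (p + q) = expSeriesFun D x p + expSeriesFun D x q := by
  ext n
  simp only [expSeriesFun, PowerSeries.coeff_mk, map_add]
  rw [iterate_map_add, map_add, add_div]

/-- Both sides satisfy the same Leibniz rule under d/dt, and in characteristic zero the coefficient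
of degree `n + 1` is recovered from that of degree `n` of the derivative. -/
theorem expSeriesFun_mul (D : Derivation K (MvPolynomial σ K) (MvPolynomial σ K))
    (x : σ → K) (p q : MvPolynomial σ K) :
    expSeriesFun D x (p * q) = expSeriesFun D x p * expSeriesFun D x q := by
  ext n
  induction n generalizing p q with
  | zero => simp [expSeriesFun]
  | succ n ih =>
    have h2 : (n + 1 : K) ≠ 0 := by exact_mod_cast n.succ_ne_zero
    have e1 := PowerSeries.coeff_derivative (expSeriesFun D x (p * q)) n
    have e2 := PowerSeries.coeff_derivative (expSeriesFun D x p * expSeriesFun D x q) n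
    rw [derivative_expSeriesFun, Derivation.leibniz, smul_eq_mul, smul_eq_mul, expSeriesFun_add,
      map_add, ih, ih] at e1
    rw [Derivation.leibniz, derivative_expSeriesFun, derivative_expSeriesFun, smul_eq_mul,
      smul_eq_mul, map_add, e1] at e2
    exact mul_right_cancel₀ h2 e2

/-- The Taylor series along a derivation, as a homomorphism of algebras. -/
noncomputable def expSeries (D : Derivation K (MvPolynomial σ K) (MvPolynomial σ K))
    (x : σ → K) : MvPolynomial σ K →ₐ[K] PowerSeries K :=
  AlgHom.ofLinearMap
    { toFun := expSeriesFun D x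
      map_add' := expSeriesFun_add D x
      map_smul' := fun c p => by
        ext n
        simp only [expSeriesFun, PowerSeries.coeff_mk, RingHom.id_apply, map_smul]
        have : (D^[n]) (c • p) = c • D^[n] p := by
          induction n generalizing p with
          | zero => rfl
          | succ n ih => rw [Function.iterate_succ_apply, Function.iterate_succ_apply,
              D.map_smul, ih]
        rw [this, smul_eval, smul_eq_mul, mul_div_assoc] }
    (by
      ext n
      rcases n with _ | n
      · simp [expSeriesFun]
      · have : ∀ n, (D^[n]) (0 : MvPolynomial σ K) = 0 := fun n => iterate_map_zero D n
        simp [expSeriesFun, PowerSeries.coeff_one, this])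
    (expSeriesFun_mul D x)

theorem coeff_expSeries (D : Derivation K (MvPolynomial σ K) (MvPolynomial σ K))
    (x : σ → K) (p : MvPolynomial σ K) (n : ℕ) :
    PowerSeries.coeff n (expSeries D x p) = eval x (D^[n] p) / (n.factorial : K) := by
  simp [expSeries, expSeriesFun]

/-- The truncation after degree `N` of the Taylor polynomials of the coordinates. -/
noncomputable def expPoly (D : Derivation K (MvPolynomial σ K) (MvPolynomial σ K)) (N : ℕ)
    (x : σ → K) : MvPolynomial σ K →ₐ[K] Polynomial K :=
  aeval fun s => ∑ n ∈ Finset.range N,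
    Polynomial.monomial n (eval x (D^[n] (X s)) / (n.factorial : K))

theorem dvd_iterate_of_le {D : Derivation K (MvPolynomial σ K) (MvPolynomial σ K)}
    {f : MvPolynomial σ K} (hf : f ∣ D f) {p : MvPolynomial σ K} {m : ℕ} (hm : f ∣ D^[m] p)
    {n : ℕ} (hmn : m ≤ n) : f ∣ D^[n] p := by
  have hD : ∀ q, f ∣ q → f ∣ D q := by
    rintro _ ⟨q, rfl⟩
    rw [Derivation.leibniz, smul_eq_mul, smul_eq_mul]
    exact dvd_add (dvd_mul_right _ _) (hf.mul_left _)
  induction n, hmn using Nat.le_induction with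
  | base => exact hm
  | succ n _ ih => rw [Function.iterate_succ_apply']; exact hD _ ih

theorem eval_eq_zero_of_dvd {f p : MvPolynomial σ K} (h : f ∣ p) {x : σ → K}
    (hx : x ∈ hypersurface f) : eval x p = 0 := by
  obtain ⟨q, rfl⟩ := h
  rw [map_mul, show eval x f = 0 from hx, zero_mul]

/-- At a point of the hypersurface the Taylor coefficients of the coordinates vanish from degree `N`
on, so truncation loses nothing on generators. Both constructions are algebra homomorphisms, hence
agree everywhere. -/
theorem coeff_expPoly {D : Derivation K (MvPolynomial σ K) (MvPolynomial σ K)}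
    {f : MvPolynomial σ K} {N : ℕ} (hf : f ∣ D f) (hN : ∀ s, f ∣ D^[N] (X s)) {x : σ → K}
    (hx : x ∈ hypersurface f) (p : MvPolynomial σ K) (n : ℕ) :
    (expPoly D N x p).coeff n = eval x (D^[n] p) / (n.factorial : K) := by
  have h : (Polynomial.coeToPowerSeries.algHom K).comp (expPoly D N x) = expSeries D x := by
    refine algHom_ext fun s => ?_
    ext n
    rw [coeff_expSeries]
    rw [AlgHom.comp_apply, Polynomial.coeToPowerSeries.algHom_apply, Algebra.algebraMap_self,
      PowerSeries.map_id, id_eq, Polynomial.coeff_coe, expPoly, aeval_X,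
      Polynomial.finsetSum_coeff]
    by_cases hn : n < N
    · simp [Polynomial.coeff_monomial, hn]
    · simp [Polynomial.coeff_monomial, hn, eval_eq_zero_of_dvd (dvd_iterate_of_le hf (hN s) (not_lt.mp hn)) hx]
  rw [← coeff_expSeries, ← h]
  simp

theorem eval_expPoly (D : Derivation K (MvPolynomial σ K) (MvPolynomial σ K)) (N : ℕ)
    (x : σ → K) (t : K) (p : MvPolynomial σ K) :
    eval (fun s => (expPoly D N x (X s)).eval t) p = (expPoly D N x p).eval t := by
  have h : aeval (fun s => (expPoly D N x (X s)).eval t) =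
      (Polynomial.aeval t).comp (expPoly D N x) := by
    refine algHom_ext fun s => ?_
    rw [AlgHom.comp_apply, aeval_X, Polynomial.coe_aeval_eq_eval]
  have := DFunLike.congr_fun h p
  rwa [AlgHom.comp_apply, Polynomial.coe_aeval_eq_eval, ← coe_aeval_eq_eval] at *

theorem expPoly_mem {D : Derivation K (MvPolynomial σ K) (MvPolynomial σ K)}
    {f : MvPolynomial σ K} {N : ℕ} (hf : f ∣ D f) (hN : ∀ s, f ∣ D^[N] (X s)) {x : σ → K}
    (hx : x ∈ hypersurface f) (t : K) :
    (fun s => (expPoly D N x (X s)).eval t) ∈ hypersurface f := by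
  have : expPoly D N x f = 0 := by
    ext n
    rw [coeff_expPoly hf hN hx, eval_eq_zero_of_dvd
      (dvd_iterate_of_le hf (m := 0) (dvd_refl f) (Nat.zero_le n)) hx]
    simp
  change eval _ f = 0
  rw [eval_expPoly, this, Polynomial.eval_zero]

/-- This is the group law: `expPoly` turns `D` into d/dt, so restarting the flow at time `t` is a
Taylor shift. -/
theorem expPoly_expPoly {D : Derivation K (MvPolynomial σ K) (MvPolynomial σ K)}
    {f : MvPolynomial σ K} {N : ℕ} (hf : f ∣ D f) (hN : ∀ s, f ∣ D^[N] (X s)) {x : σ → K}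
    (hx : x ∈ hypersurface f) (t : K) (p : MvPolynomial σ K) :
    expPoly D N (fun s => (expPoly D N x (X s)).eval t) p =
      Polynomial.taylor t (expPoly D N x p) := by
  ext n
  have hfac : (n.factorial : K) ≠ 0 := by exact_mod_cast n.factorial_ne_zero
  rw [coeff_expPoly hf hN (expPoly_mem hf hN hx t), eval_expPoly, Polynomial.taylor_coeff]
  have hder : ∀ q, expPoly D N x (D q) = Polynomial.derivative (expPoly D N x q) := by
    intro q
    ext k
    have hk : (k.factorial : K) ≠ 0 := by exact_mod_cast k.factorial_ne_zero
    have hk' : (k + 1 : K) ≠ 0 := by exact_mod_cast k.succ_ne_zero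
    rw [Polynomial.coeff_derivative, coeff_expPoly hf hN hx, coeff_expPoly hf hN hx,
      ← Function.iterate_succ_apply, Nat.factorial_succ]
    push_cast
    field_simp
  have hiter : ∀ k, expPoly D N x (D^[k] p) = Polynomial.derivative^[k] (expPoly D N x p) := by
    intro k
    induction k with
    | zero => rfl
    | succ k ih => rw [Function.iterate_succ_apply', Function.iterate_succ_apply', hder, ih]
  rw [hiter, ← Polynomial.factorial_smul_hasseDeriv, LinearMap.smul_apply, nsmul_eq_mul,
    Polynomial.eval_mul, Polynomial.eval_natCast]
  field_simp

/-- The action of `(K, +)` on a hypersurface by the exponentials of a locally nilpotent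
derivation. -/
@[reducible]
noncomputable def expAction {D : Derivation K (MvPolynomial σ K) (MvPolynomial σ K)}
    {f : MvPolynomial σ K} {N : ℕ} (hf : f ∣ D f) (hN : ∀ s, f ∣ D^[N] (X s)) :
    AddAction K (hypersurface f) where
  vadd t x := ⟨fun s => (expPoly D N x (X s)).eval t, expPoly_mem hf hN x.2 t⟩
  zero_vadd x := by
    refine Subtype.ext (funext fun s => ?_)
    change (expPoly D N x (X s)).eval 0 = _
    rw [← Polynomial.coeff_zero_eq_eval_zero, coeff_expPoly hf hN x.2]
    simp
  add_vadd s t x := by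
    refine Subtype.ext (funext fun j => ?_)
    change (expPoly D N x (X j)).eval (s + t) =
      (expPoly D N (fun s => (expPoly D N x (X s)).eval t) (X j)).eval s
    rw [expPoly_expPoly hf hN x.2, Polynomial.taylor_eval]

/-- Rigidity makes the exponential action trivial, so orbits are constant in `t`; their linear
coefficient is the value of `D (X s)`, which therefore vanishes on the hypersurface. -/
theorem IsRigidVariety.dvd_derivation [Finite σ] {f : MvPolynomial σ K}
    (hrigid : IsRigidVariety (hypersurface f))
    (hrad : ∀ p, (∀ x ∈ hypersurface f, eval x p = 0) → f ∣ p)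
    {D : Derivation K (MvPolynomial σ K) (MvPolynomial σ K)} (hf : f ∣ D f)
    (hnil : ∀ s, ∃ N, f ∣ D^[N] (X s)) (s : σ) : f ∣ D (X s) := by
  classical
  have := Fintype.ofFinite σ
  choose M hM using hnil
  obtain ⟨N, hN⟩ : ∃ N, ∀ s, f ∣ D^[N] (X s) :=
    ⟨∑ s, M s, fun s => dvd_iterate_of_le hf (hM s)
      (Finset.single_le_sum (fun _ _ => Nat.zero_le _) (Finset.mem_univ s))⟩
  let _ := expAction hf hN
  have key := hrigid (by
    refine ⟨fun j => ∑ n ∈ Finset.range N,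
      rename some (D^[n] (X j)) * C ((n.factorial : K)⁻¹) * X none ^ n, fun t x j => ?_⟩
    change (expPoly D N x (X j)).eval t = _
    simp only [expPoly, aeval_X, Polynomial.eval_finsetSum, Polynomial.eval_monomial, map_sum,
      map_mul, map_pow, eval_X, eval_C, eval_rename, Function.comp_def, Option.elim, div_eq_mul_inv])
  refine hrad _ fun x hx => ?_
  have h1 : expPoly D N x (X s) = Polynomial.C (x s) := by
    refine Polynomial.funext fun t => ?_
    rw [Polynomial.eval_C]
    exact congrFun (congrArg Subtype.val (key t ⟨x, hx⟩)) s
  have h2 := coeff_expPoly hf hN hx (X s) 1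
  rw [h1, Polynomial.coeff_C] at h2
  simpa using h2.symm

end LocallyNilpotent

/-! ### Homogeneous components of derivations for a weight grading -/

section Graded

variable {K σ M : Type*} [Field K] [AddCommGroup M]

theorem weightedHomogeneousComponent_mul {w : σ → M} {f : MvPolynomial σ K} {d : M}
    (hf : f.IsWeightedHomogeneous w d) (h : MvPolynomial σ K) (n : M) :
    weightedHomogeneousComponent w n (f * h) =
      f * weightedHomogeneousComponent w (n - d) h := by
  induction h using MvPolynomial.induction_on' with
  | monomial a r =>
    have ha := isWeightedHomogeneous_monomial w a r rfl
    by_cases hn : n = d + Finsupp.weight w a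
    · subst hn
      rw [add_sub_cancel_left, weightedHomogeneousComponent_eq_self ha,
        weightedHomogeneousComponent_eq_self (hf.mul ha)]
    · rw [(hf.mul ha).weightedHomogeneousComponent_ne n hn,
        ha.weightedHomogeneousComponent_ne _ (fun h => hn (by rw [← h]; abel)), mul_zero]
  | add p q hp hq => rw [mul_add, map_add, hp, hq, map_add, mul_add]

theorem dvd_weightedHomogeneousComponent {w : σ → M} {f : MvPolynomial σ K} {d : M}
    (hf : f.IsWeightedHomogeneous w d) {h : MvPolynomial σ K} (hfh : f ∣ h) (n : M) :
    f ∣ weightedHomogeneousComponent w n h := by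
  obtain ⟨q, rfl⟩ := hfh
  rw [weightedHomogeneousComponent_mul hf]
  exact dvd_mul_right _ _

/-- The homogeneous component of degree `k` of a derivation. -/
noncomputable def derivationComponent (w : σ → M)
    (D : Derivation K (MvPolynomial σ K) (MvPolynomial σ K)) (k : M) :
    Derivation K (MvPolynomial σ K) (MvPolynomial σ K) :=
  mkDerivation K fun s => weightedHomogeneousComponent w (w s + k) (D (X s))

theorem weightedHomogeneousComponent_derivation_monomial (w : σ → M)
    (D : Derivation K (MvPolynomial σ K) (MvPolynomial σ K)) (n : M) (a : σ →₀ ℕ) (r : K) :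
    weightedHomogeneousComponent w n (D (monomial a r)) =
      derivationComponent w D (n - Finsupp.weight w a) (monomial a r) := by
  have hD : D = mkDerivation K fun s => D (X s) :=
    derivation_ext fun s => (mkDerivation_X K (fun s => D (X s)) s).symm
  conv_lhs => rw [hD]
  rw [derivationComponent, mkDerivation_monomial, mkDerivation_monomial, map_smul, Finsupp.sum,
    Finsupp.sum, map_sum]
  congr 1
  refine Finset.sum_congr rfl fun s hs => ?_
  rw [smul_eq_mul, smul_eq_mul,
    weightedHomogeneousComponent_mul (isWeightedHomogeneous_monomial w _ _ rfl)]
  congr 3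
  have h1 : a - Finsupp.single s 1 + Finsupp.single s 1 = a :=
    tsub_add_cancel_of_le (by
      rw [Finsupp.single_le_iff]
      exact Nat.one_le_iff_ne_zero.mpr (Finsupp.mem_support_iff.mp hs))
  have h2 := congrArg (Finsupp.weight w) h1
  rw [map_add, Finsupp.weight_single, one_smul] at h2
  rw [← h2]
  abel

theorem derivationComponent_of_isWeightedHomogeneous {w : σ → M}
    (D : Derivation K (MvPolynomial σ K) (MvPolynomial σ K)) {p : MvPolynomial σ K} {n : M}
    (hp : p.IsWeightedHomogeneous w n) (k : M) :
    derivationComponent w D k p = weightedHomogeneousComponent w (n + k) (D p) := by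
  conv_lhs => rw [p.as_sum]
  conv_rhs => rw [p.as_sum]
  simp only [map_sum]
  refine Finset.sum_congr rfl fun a ha => ?_
  rw [weightedHomogeneousComponent_derivation_monomial, hp (mem_support_iff.mp ha),
    add_sub_cancel_left]

end Graded

/-! ### Nonzero-degree components of diagonalizable derivations -/

section TopComponent

variable {K σ : Type*} [Field K]

/-- The polynomials all of whose monomials have weight at most `N`. -/
def weightLE (K : Type*) [Field K] {σ : Type*} (w : σ → ℤ) (N : ℤ) :
    Submodule K (MvPolynomial σ K) where
  carrier := {p | ∀ a, coeff a p ≠ 0 → Finsupp.weight w a ≤ N}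
  add_mem' {p q} hp hq a ha := by
    rw [coeff_add] at ha
    by_cases h : coeff a p = 0
    · rw [h, zero_add] at ha
      exact hq a ha
    · exact hp a h
  zero_mem' a ha := absurd (coeff_zero a) ha
  smul_mem' c p hp a ha := by
    rw [coeff_smul] at ha
    exact hp a (right_ne_zero_of_smul ha)

theorem weightLE_mono {w : σ → ℤ} {m n : ℤ} (h : m ≤ n) : weightLE K w m ≤ weightLE K w n :=
  fun _ hp a ha => (hp a ha).trans h

theorem exists_mem_weightLE (w : σ → ℤ) (p : MvPolynomial σ K) :
    ∃ N : ℕ, p ∈ weightLE K w N := by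
  refine ⟨∑ a ∈ p.support, (Finsupp.weight w a).natAbs, fun a ha => ?_⟩
  have := Finset.single_le_sum (f := fun a => (Finsupp.weight w a).natAbs)
    (fun _ _ => Nat.zero_le _) (mem_support_iff.mpr ha)
  omega

theorem weightedHomogeneousComponent_of_mem_weightLE {w : σ → ℤ} {N n : ℤ}
    {p : MvPolynomial σ K} (hp : p ∈ weightLE K w N) (hn : N < n) :
    weightedHomogeneousComponent w n p = 0 := by
  ext a
  rw [coeff_weightedHomogeneousComponent, coeff_zero]
  split_ifs with h
  · by_contra h0
    exact absurd (hp a h0) (by omega)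
  · rfl

theorem mem_weightLE_of_forall {w : σ → ℤ} {N : ℤ} {p : MvPolynomial σ K}
    (h : ∀ n, N < n → weightedHomogeneousComponent w n p = 0) : p ∈ weightLE K w N := by
  intro a ha
  by_contra hlt
  have := congrArg (coeff a) (h _ (not_le.mp hlt))
  rw [coeff_weightedHomogeneousComponent, if_pos rfl, coeff_zero] at this
  exact ha this

theorem derivationComponent_eq_zero {w : σ → ℤ}
    {D : Derivation K (MvPolynomial σ K) (MvPolynomial σ K)} {k k' : ℤ}
    (hD : ∀ s, D (X s) ∈ weightLE K w (w s + k)) (hk : k < k') :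
    derivationComponent w D k' = 0 := by
  refine derivation_ext fun s => ?_
  rw [derivationComponent, mkDerivation_X,
    weightedHomogeneousComponent_of_mem_weightLE (hD s) (by omega)]
  rfl

theorem derivation_mem_weightLE {w : σ → ℤ}
    {D : Derivation K (MvPolynomial σ K) (MvPolynomial σ K)} {k N : ℤ}
    (hD : ∀ s, D (X s) ∈ weightLE K w (w s + k)) {p : MvPolynomial σ K}
    (hp : p ∈ weightLE K w N) :
    D p ∈ weightLE K w (N + k) ∧ weightedHomogeneousComponent w (N + k) (D p) =
      derivationComponent w D k (weightedHomogeneousComponent w N p) := by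
  constructor
  · refine mem_weightLE_of_forall fun n hn => ?_
    rw [p.as_sum, map_sum, map_sum]
    refine Finset.sum_eq_zero fun a ha => ?_
    have := hp a (mem_support_iff.mp ha)
    rw [weightedHomogeneousComponent_derivation_monomial,
      derivationComponent_eq_zero hD (by omega)]
    rfl
  · conv_lhs => rw [p.as_sum]
    conv_rhs => rw [p.as_sum]
    simp only [map_sum]
    refine Finset.sum_congr rfl fun a ha => ?_
    have h1 := hp a (mem_support_iff.mp ha)
    have h2 := isWeightedHomogeneous_monomial w a (coeff a p) rfl
    rw [weightedHomogeneousComponent_derivation_monomial]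
    rcases h1.eq_or_lt with h | h
    · rw [weightedHomogeneousComponent_eq_self (h ▸ h2), h, add_sub_cancel_left]
    · rw [h2.weightedHomogeneousComponent_ne N h.ne', map_zero,
        derivationComponent_eq_zero hD (by omega)]
      rfl

theorem iterate_derivation_mem_weightLE {w : σ → ℤ}
    {D : Derivation K (MvPolynomial σ K) (MvPolynomial σ K)} {k N : ℤ}
    (hD : ∀ s, D (X s) ∈ weightLE K w (w s + k)) {p : MvPolynomial σ K}
    (hp : p ∈ weightLE K w N) (j : ℕ) :
    D^[j] p ∈ weightLE K w (N + j * k) ∧ weightedHomogeneousComponent w (N + j * k) (D^[j] p) =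
      (derivationComponent w D k)^[j] (weightedHomogeneousComponent w N p) := by
  induction j with
  | zero => simpa using hp
  | succ j ih =>
    have := derivation_mem_weightLE hD ih.1
    rw [Function.iterate_succ_apply', Function.iterate_succ_apply', ← ih.2,
      show N + ((j + 1 : ℕ) : ℤ) * k = N + j * k + k by push_cast; ring]
    exact this

/-- A derivation of the polynomial ring which is diagonalizable modulo `f`. -/
def DiagonalizableMod (f : MvPolynomial σ K)
    (D : Derivation K (MvPolynomial σ K) (MvPolynomial σ K)) : Prop :=
  Submodule.span K {q | ∃ μ : K, f ∣ D q - μ • q} = ⊤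

theorem dvd_derivation_of_dvd {f : MvPolynomial σ K}
    {D : Derivation K (MvPolynomial σ K) (MvPolynomial σ K)} (hf : f ∣ D f)
    {q : MvPolynomial σ K} (hq : f ∣ q) : f ∣ D q := by
  obtain ⟨r, rfl⟩ := hq
  rw [Derivation.leibniz, smul_eq_mul, smul_eq_mul]
  exact dvd_add (dvd_mul_right _ _) (hf.mul_left _)

/-- Modulo `f`, `p` is a finite combination of eigenvectors, and iterating `D` only rescales them;
the bound `B` is thus uniform in `j`. -/
theorem DiagonalizableMod.exists_weightLE {f : MvPolynomial σ K}
    {D : Derivation K (MvPolynomial σ K) (MvPolynomial σ K)} (hD : DiagonalizableMod f D)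
    (hf : f ∣ D f) (w : σ → ℤ) (p : MvPolynomial σ K) :
    ∃ B : ℕ, ∀ j : ℕ, ∃ q ∈ weightLE K w B, f ∣ D^[j] p - q := by
  have hp : p ∈ Submodule.span K {q | ∃ μ : K, f ∣ D q - μ • q} := by
    rw [show Submodule.span K _ = ⊤ from hD]
    trivial
  induction hp using Submodule.span_induction with
  | mem p hp =>
    obtain ⟨μ, hμ⟩ := hp
    obtain ⟨B, hB⟩ := exists_mem_weightLE w p
    refine ⟨B, fun j => ⟨μ ^ j • p, Submodule.smul_mem _ _ hB, ?_⟩⟩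
    induction j with
    | zero => simp
    | succ j ih =>
      have h1 := dvd_derivation_of_dvd hf ih
      have h2 := hμ.mul_left (C (μ ^ j))
      rw [← smul_eq_C_mul] at h2
      have h3 := dvd_add h1 h2
      rw [map_sub, D.map_smul, smul_sub, sub_add_sub_cancel, smul_smul, ← pow_succ] at h3
      rwa [Function.iterate_succ_apply']
  | zero => exact ⟨0, fun j => ⟨0, Submodule.zero_mem _, by rw [iterate_map_zero, sub_zero]; simp⟩⟩
  | add p q _ _ hp hq =>
    obtain ⟨B, hB⟩ := hp
    obtain ⟨B', hB'⟩ := hq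
    refine ⟨B + B', fun j => ?_⟩
    obtain ⟨a, ha, ha'⟩ := hB j
    obtain ⟨b, hb, hb'⟩ := hB' j
    refine ⟨a + b, Submodule.add_mem _ (weightLE_mono (by push_cast; omega) ha)
      (weightLE_mono (by push_cast; omega) hb), ?_⟩
    rw [iterate_map_add, add_sub_add_comm]
    exact dvd_add ha' hb'
  | smul c p _ hp =>
    obtain ⟨B, hB⟩ := hp
    refine ⟨B, fun j => ?_⟩
    obtain ⟨a, ha, ha'⟩ := hB j
    refine ⟨c • a, Submodule.smul_mem _ _ ha, ?_⟩
    have : (D^[j]) (c • p) = c • D^[j] p := by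
      clear hB ha ha'
      induction j with
      | zero => rfl
      | succ j ih => rw [Function.iterate_succ_apply', ih, D.map_smul, Function.iterate_succ_apply']
    rw [this, ← smul_sub, smul_eq_C_mul]
    exact ha'.mul_left _

theorem dvd_derivation_sub_derivation {f : MvPolynomial σ K}
    {D D' : Derivation K (MvPolynomial σ K) (MvPolynomial σ K)}
    (h : ∀ s, f ∣ D (X s) - D' (X s)) (p : MvPolynomial σ K) : f ∣ D p - D' p := by
  induction p using MvPolynomial.induction_on with
  | C a => simp
  | add p q hp hq =>
    rw [map_add, map_add, add_sub_add_comm]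
    exact dvd_add hp hq
  | mul_X p s hp =>
    rw [Derivation.leibniz, Derivation.leibniz, add_sub_add_comm, ← smul_sub, ← smul_sub]
    exact dvd_add ((h s).mul_left _) (hp.mul_left _)

theorem DiagonalizableMod.congr {f : MvPolynomial σ K}
    {D D' : Derivation K (MvPolynomial σ K) (MvPolynomial σ K)} (hD : DiagonalizableMod f D)
    (h : ∀ s, f ∣ D (X s) - D' (X s)) : DiagonalizableMod f D' := by
  refine eq_top_iff.mpr (hD.ge.trans (Submodule.span_mono ?_))
  rintro q ⟨μ, hμ⟩
  refine ⟨μ, ?_⟩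
  have := dvd_sub hμ (dvd_derivation_sub_derivation h q)
  rwa [sub_right_comm, sub_sub_cancel] at this

variable [CharZero K] [Finite σ]

/-- The top component is locally nilpotent modulo `f`: its `j`-th iterate on `X s` is the part of
weight `w s + j * k` of `D^[j] (X s)`, whereas modulo `f` those iterates have bounded weight.
Rigidity then applies. -/
theorem dvd_top_component {f : MvPolynomial σ K} (hrigid : IsRigidVariety (hypersurface f))
    (hrad : ∀ p, (∀ x ∈ hypersurface f, eval x p = 0) → f ∣ p) {w : σ → ℤ} {d : ℤ}
    (hw : f.IsWeightedHomogeneous w d)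
    {D : Derivation K (MvPolynomial σ K) (MvPolynomial σ K)} (hf : f ∣ D f)
    (hD : DiagonalizableMod f D) {k : ℤ} (hk : 0 < k)
    (hle : ∀ s, D (X s) ∈ weightLE K w (w s + k)) (s : σ) :
    f ∣ weightedHomogeneousComponent w (w s + k) (D (X s)) := by
  have hf' : f ∣ derivationComponent w D k f := by
    rw [derivationComponent_of_isWeightedHomogeneous D hw]
    exact dvd_weightedHomogeneousComponent hw hf _
  have key := hrigid.dvd_derivation hrad hf' (fun s => ?_) s
  · rwa [derivationComponent, mkDerivation_X] at key
  · obtain ⟨B, hB⟩ := hD.exists_weightLE hf w (X s)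
    have hX := isWeightedHomogeneous_X K w s
    have hs : (X s : MvPolynomial σ K) ∈ weightLE K w (w s) := fun a ha => (hX ha).le
    -- Enough iterations for the weight to exceed `B`, even if `w s` is negative, since `k ≥ 1`.
    refine ⟨B + (w s).natAbs + 1, ?_⟩
    obtain ⟨q, hq, hq'⟩ := hB (B + (w s).natAbs + 1)
    have h1 := (iterate_derivation_mem_weightLE hle hs (B + (w s).natAbs + 1)).2
    rw [weightedHomogeneousComponent_eq_self hX] at h1
    rw [← h1]
    have h2 := dvd_weightedHomogeneousComponent hw hq'
      (w s + ((B + (w s).natAbs + 1 : ℕ) : ℤ) * k)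
    rwa [map_sub, weightedHomogeneousComponent_of_mem_weightLE hq, sub_zero] at h2
    have : ((B + (w s).natAbs + 1 : ℕ) : ℤ) ≤ ((B + (w s).natAbs + 1 : ℕ) : ℤ) * k :=
      le_mul_of_one_le_right (by positivity) hk
    have := neg_abs_le (w s)
    push_cast at *
    omega

/-- Once the top component is divisible by `f`, subtracting it changes nothing modulo `f` and lowers
the bound on the degree shift; hence the induction on `j` with `D` varying. -/
theorem dvd_positive_component {f : MvPolynomial σ K} (hrigid : IsRigidVariety (hypersurface f))
    (hrad : ∀ p, (∀ x ∈ hypersurface f, eval x p = 0) → f ∣ p) {w : σ → ℤ} {d : ℤ}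
    (hw : f.IsWeightedHomogeneous w d)
    {D : Derivation K (MvPolynomial σ K) (MvPolynomial σ K)} (hf : f ∣ D f)
    (hD : DiagonalizableMod f D) {k : ℤ} (hk : 0 < k) (s : σ) :
    f ∣ weightedHomogeneousComponent w (w s + k) (D (X s)) := by
  obtain ⟨j, hj⟩ : ∃ j : ℕ, ∀ s, D (X s) ∈ weightLE K w (w s + j) := by
    have := Fintype.ofFinite σ
    choose N hN using fun s => exists_mem_weightLE w (D (X s))
    refine ⟨∑ s, (N s + (w s).natAbs), fun s => weightLE_mono ?_ (hN s)⟩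
    have := Finset.single_le_sum (f := fun s => N s + (w s).natAbs)
      (fun _ _ => Nat.zero_le _) (Finset.mem_univ s)
    omega
  induction j generalizing D s with
  | zero =>
    rw [weightedHomogeneousComponent_of_mem_weightLE (hj s) (by push_cast; omega)]
    exact dvd_zero _
  | succ j ih =>
    have htop := dvd_top_component hrigid hrad hw hf hD (k := ((j + 1 : ℕ) : ℤ)) (by positivity) hj
    set D' : Derivation K (MvPolynomial σ K) (MvPolynomial σ K) := mkDerivation K fun s =>
      D (X s) - weightedHomogeneousComponent w (w s + ((j + 1 : ℕ) : ℤ)) (D (X s)) with hD'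
    have hX : ∀ s, D' (X s) =
      D (X s) - weightedHomogeneousComponent w (w s + ((j + 1 : ℕ) : ℤ)) (D (X s)) :=
      fun s => mkDerivation_X K _ s
    have hdiff : ∀ s, f ∣ D (X s) - D' (X s) := fun s => by rw [hX, sub_sub_cancel]; exact htop s
    have h1 : f ∣ D' f := by
      have := dvd_sub hf (dvd_derivation_sub_derivation hdiff f)
      rwa [sub_sub_cancel] at this
    have h2 := ih h1 (hD.congr hdiff) s (fun s => by
      rw [hX]
      refine mem_weightLE_of_forall fun n hn => ?_
      rw [map_sub]
      by_cases hn' : n = w s + ((j + 1 : ℕ) : ℤ)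
      · rw [hn', weightedHomogeneousComponent_eq_self
          (weightedHomogeneousComponent_isWeightedHomogeneous _ _), sub_self]
      · rw [weightedHomogeneousComponent_of_mem_weightLE (hj s) (by push_cast at hn' ⊢; omega),
          (weightedHomogeneousComponent_isWeightedHomogeneous _ _).weightedHomogeneousComponent_ne
          n hn', sub_zero])
    rw [hX, map_sub] at h2
    exact (dvd_sub_left (dvd_weightedHomogeneousComponent hw (htop s) _)).mp h2

theorem weight_neg (w : σ → ℤ) (a : σ →₀ ℕ) :
    Finsupp.weight (-w) a = -Finsupp.weight w a := by
  simp [Finsupp.weight_apply, Finsupp.sum]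

theorem dvd_nonzero_component {f : MvPolynomial σ K} (hrigid : IsRigidVariety (hypersurface f))
    (hrad : ∀ p, (∀ x ∈ hypersurface f, eval x p = 0) → f ∣ p) {w : σ → ℤ} {d : ℤ}
    (hw : f.IsWeightedHomogeneous w d)
    {D : Derivation K (MvPolynomial σ K) (MvPolynomial σ K)} (hf : f ∣ D f)
    (hD : DiagonalizableMod f D) (s : σ) {n : ℤ} (hn : n ≠ w s) :
    f ∣ weightedHomogeneousComponent w n (D (X s)) := by
  rcases lt_or_gt_of_ne hn with h | h
  · have hw' : f.IsWeightedHomogeneous (-w) (-d) := fun a ha => by rw [weight_neg, hw ha]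
    have := dvd_positive_component hrigid hrad hw' hf hD (k := w s - n) (by omega) s
    convert this using 1
    ext a
    rw [coeff_weightedHomogeneousComponent, coeff_weightedHomogeneousComponent, weight_neg]
    refine if_congr ?_ rfl rfl
    rw [Pi.neg_apply]
    omega
  · have := dvd_positive_component hrigid hrad hw hf hD (k := n - w s) (by omega) s
    rwa [add_sub_cancel] at this

end TopComponent

/-! ### The subalgebra of locally nilpotent elements -/

section LocallyNilpotentElements

variable {K σ : Type*} [Field K]

theorem iterate_derivation_mul_eq_zero (D : Derivation K (MvPolynomial σ K) (MvPolynomial σ K))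
    {n : ℕ} : ∀ {a b : ℕ} {p q : MvPolynomial σ K}, a + b ≤ n → D^[a] p = 0 → D^[b] q = 0 →
      D^[n] (p * q) = 0 := by
  induction n with
  | zero =>
    intro a b p q h hp _
    obtain rfl : a = 0 := by omega
    rw [show p = 0 from hp, zero_mul, iterate_map_zero]
  | succ n ih =>
    intro a b p q h hp hq
    rcases a with _ | a
    · rw [show p = 0 from hp, zero_mul, iterate_map_zero]
    rcases b with _ | b
    · rw [show q = 0 from hq, mul_zero, iterate_map_zero]
    rw [Function.iterate_succ_apply, Derivation.leibniz, smul_eq_mul, smul_eq_mul,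
      iterate_map_add, ih (a := a + 1) (b := b) (by omega) hp hq,
      ih (a := b + 1) (b := a) (by omega) hq hp, add_zero]

/-- The subalgebra of elements annihilated by a power of a derivation. -/
def locallyNilpotentSubalgebra (D : Derivation K (MvPolynomial σ K) (MvPolynomial σ K)) :
    Subalgebra K (MvPolynomial σ K) where
  carrier := {p | ∃ n, D^[n] p = 0}
  mul_mem' := by
    rintro p q ⟨a, ha⟩ ⟨b, hb⟩
    exact ⟨a + b, iterate_derivation_mul_eq_zero D le_rfl ha hb⟩
  add_mem' := by
    rintro p q ⟨a, ha⟩ ⟨b, hb⟩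
    refine ⟨a + b, ?_⟩
    rw [iterate_map_add, add_comm a b, Function.iterate_add_apply, ha, add_comm b a,
      Function.iterate_add_apply, hb, iterate_map_zero, iterate_map_zero, add_zero]
  algebraMap_mem' r := ⟨1, by simp⟩

theorem mem_locallyNilpotentSubalgebra_of_derivation
    {D : Derivation K (MvPolynomial σ K) (MvPolynomial σ K)} {p : MvPolynomial σ K}
    (h : D p ∈ locallyNilpotentSubalgebra D) : p ∈ locallyNilpotentSubalgebra D := by
  obtain ⟨n, hn⟩ := h
  exact ⟨n + 1, hn⟩

theorem monomial_mem_subalgebra {S : Subalgebra K (MvPolynomial σ K)} {a : σ →₀ ℕ}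
    (h : ∀ v, a v ≠ 0 → (X v : MvPolynomial σ K) ∈ S) (r : K) : monomial a r ∈ S := by
  rw [monomial_eq]
  exact S.mul_mem (S.algebraMap_mem r)
    (S.prod_mem fun v hv => S.pow_mem (h v (Finsupp.mem_support_iff.mp hv)) _)

theorem derivation_monomial_eq_zero {D : Derivation K (MvPolynomial σ K) (MvPolynomial σ K)}
    {a : σ →₀ ℕ} (h : ∀ v, a v ≠ 0 → D (X v) = 0) (r : K) : D (monomial a r) = 0 :=
  derivation_eq_zero_of_forall_mem_vars fun v hv => h v (by
    classical
    obtain ⟨d, hd, hv⟩ := (mem_vars_iff_mem_support v).mp hv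
    rw [Finset.mem_singleton.mp (support_monomial_subset hd)] at hv
    exact Finsupp.mem_support_iff.mp hv)

theorem derivation_eq_sum_pderiv [Fintype σ]
    (D : Derivation K (MvPolynomial σ K) (MvPolynomial σ K)) (p : MvPolynomial σ K) :
    D p = ∑ s, pderiv s p * D (X s) := by
  induction p using MvPolynomial.induction_on with
  | C a => simp
  | add p q hp hq => simp only [map_add, add_mul, Finset.sum_add_distrib, hp, hq]
  | mul_X p t hp =>
    classical
    simp only [add_mul, Finset.sum_add_distrib, pderiv_X, Derivation.leibniz, hp,
      smul_eq_mul, Finset.mul_sum]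
    have h : ∑ s, p * (Pi.single s 1 : σ → MvPolynomial σ K) t * D (X s) = p * D (X t) := by
      rw [Finset.sum_eq_single t]
      · rw [Pi.single_eq_same, mul_one]
      · intro s _ hs
        rw [Pi.single_eq_of_ne' hs, mul_zero, zero_mul]
      · simp
    rw [h]
    congr 1
    exact Finset.sum_congr rfl fun s _ => by ring

end LocallyNilpotentElements

/-! ### Trinomials are squarefree and generate their vanishing ideals -/

section Trinomials

variable {K σ : Type*} [Finite σ]

/-- The exponent of the `i`-th monomial of a trinomial, the variable `s` belonging to
the group `gr s` and having the exponent `l s`. -/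
noncomputable def groupExponent (gr : σ → Fin 3) (l : σ → ℕ) (i : Fin 3) : σ →₀ ℕ :=
  Finsupp.equivFunOnFinite.symm fun s => if gr s = i then l s else 0

theorem groupExponent_apply (gr : σ → Fin 3) (l : σ → ℕ) (i : Fin 3) (s : σ) :
    groupExponent gr l i s = if gr s = i then l s else 0 := rfl

/-- The trinomial with variables `σ` divided into three groups. -/
noncomputable def groupedTrinomial (K : Type*) [CommSemiring K] (gr : σ → Fin 3) (l : σ → ℕ) :
    MvPolynomial σ K :=
  ∑ i, monomial (groupExponent gr l i) 1

variable {gr : σ → Fin 3} {l : σ → ℕ}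

theorem groupExponent_injective (hgr : gr.Surjective) (hl : ∀ s, 0 < l s) :
    (groupExponent gr l).Injective := by
  intro i j h
  obtain ⟨s, rfl⟩ := hgr i
  have := DFunLike.congr_fun h s
  rw [groupExponent_apply, groupExponent_apply, if_pos rfl] at this
  by_contra hne
  rw [if_neg hne] at this
  exact (hl s).ne' this

variable [Field K]

theorem coeff_groupedTrinomial (hgr : gr.Surjective) (hl : ∀ s, 0 < l s) (i : Fin 3) :
    coeff (groupExponent gr l i) (groupedTrinomial K gr l) = 1 := by
  classical
  rw [groupedTrinomial, coeff_sum, Finset.sum_eq_single i]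
  · rw [coeff_monomial, if_pos rfl]
  · intro j _ hj
    rw [coeff_monomial, if_neg fun h => hj (groupExponent_injective hgr hl h)]
  · simp

theorem coeff_groupedTrinomial_of_ne {a : σ →₀ ℕ} (h : ∀ i, a ≠ groupExponent gr l i) :
    coeff a (groupedTrinomial K gr l) = 0 := by
  classical
  rw [groupedTrinomial, coeff_sum]
  exact Finset.sum_eq_zero fun i _ => by rw [coeff_monomial, if_neg (h i).symm]

theorem pderiv_groupedTrinomial (s : σ) : pderiv s (groupedTrinomial K gr l) =
    monomial (groupExponent gr l (gr s) - Finsupp.single s 1) (l s : K) := by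
  rw [groupedTrinomial, map_sum, Finset.sum_eq_single (gr s)]
  · rw [pderiv_monomial, groupExponent_apply, if_pos rfl, one_mul]
  · intro i _ hi
    rw [pderiv_monomial, groupExponent_apply, if_neg hi.symm]
    simp
  · simp

theorem X_mul_pderiv_groupedTrinomial (hl : ∀ s, 0 < l s) (s : σ) :
    X s * pderiv s (groupedTrinomial K gr l) =
      monomial (groupExponent gr l (gr s)) (l s : K) := by
  rw [pderiv_groupedTrinomial, X, monomial_mul, one_mul, add_tsub_cancel_of_le]
  rw [Finsupp.single_le_iff, groupExponent_apply, if_pos rfl]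
  exact hl s

/-- An irreducible factor would be associated to a variable occurring in both monomials. -/
theorem isUnit_of_dvd_monomial {q : MvPolynomial σ K} {a b : σ →₀ ℕ} {r r' : K} (hr : r ≠ 0)
    (hr' : r' ≠ 0) (ha : q ∣ monomial a r) (hb : q ∣ monomial b r')
    (hab : ∀ s, a s = 0 ∨ b s = 0) : IsUnit q := by
  classical
  have := Fintype.ofFinite σ
  by_contra hq
  have hq0 : q ≠ 0 := by
    rintro rfl
    exact hr (monomial_eq_zero.mp (zero_dvd_iff.mp ha))
  obtain ⟨p, hp, hpq⟩ := WfDvdMonoid.exists_irreducible_factor hq hq0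
  have hp' := UniqueFactorizationMonoid.irreducible_iff_prime.mp hp
  have key : ∀ (c : σ →₀ ℕ) (r : K), r ≠ 0 → p ∣ monomial c r →
      ∃ s, c s ≠ 0 ∧ p ∣ (X s : MvPolynomial σ K) := by
    intro c r hr h
    rw [monomial_eq] at h
    rcases hp'.dvd_or_dvd h with h | h
    · exact absurd (isUnit_of_dvd_unit h (hr.isUnit.map C)) hp.not_isUnit
    · obtain ⟨s, hs, h⟩ := hp'.exists_mem_finset_dvd h
      exact ⟨s, Finsupp.mem_support_iff.mp hs, hp'.dvd_of_dvd_pow h⟩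
  obtain ⟨s, hs, hps⟩ := key a r hr (hpq.trans ha)
  obtain ⟨t, ht, hpt⟩ := key b r' hr' (hpq.trans hb)
  have hst : (X s : MvPolynomial σ K) ∣ X t :=
    ((hp.associated_of_dvd (X_prime.irreducible) hps).symm.dvd).trans hpt
  rw [X_dvd_X] at hst
  subst hst
  rcases hab s with h | h
  · exact hs h
  · exact ht h

/-- If `q * q` divides the trinomial, `q` divides all partial derivatives. By Euler's trick of
multiplying by `X s`, it divides two coprime monomials. -/
theorem squarefree_groupedTrinomial [CharZero K] (hgr : gr.Surjective) (hl : ∀ s, 0 < l s) :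
    Squarefree (groupedTrinomial K gr l) := by
  rintro q ⟨r, hr⟩
  have hmono : ∀ s, q ∣ monomial (groupExponent gr l (gr s)) (l s : K) := by
    intro s
    rw [← X_mul_pderiv_groupedTrinomial hl, hr, mul_assoc, pderiv_mul]
    exact (dvd_add ((dvd_mul_right q r).mul_left _) (dvd_mul_right q _)).mul_left _
  obtain ⟨s, hs⟩ := hgr 0
  obtain ⟨t, ht⟩ := hgr 1
  refine isUnit_of_dvd_monomial (by exact_mod_cast (hl s).ne') (by exact_mod_cast (hl t).ne')
    (hmono s) (hmono t) fun v => ?_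
  rw [groupExponent_apply, groupExponent_apply, hs, ht]
  by_cases h : gr v = 0
  · right
    simp [h]
  · left
    simp [h]

theorem dvd_of_eval_eq_zero [IsAlgClosed K] [CharZero K] (hgr : gr.Surjective)
    (hl : ∀ s, 0 < l s) (p : MvPolynomial σ K)
    (hp : ∀ x ∈ hypersurface (groupedTrinomial K gr l), eval x p = 0) :
    groupedTrinomial K gr l ∣ p := by
  have h : p ∈ vanishingIdeal K (zeroLocus K (Ideal.span {groupedTrinomial K gr l})) := by
    intro x hx
    rw [aeval_eq_eval]
    refine hp x ?_
    have := hx _ (Ideal.mem_span_singleton_self _)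
    rwa [aeval_eq_eval] at this
  rw [vanishingIdeal_zeroLocus_eq_radical] at h
  obtain ⟨n, hn⟩ := h
  exact (squarefree_groupedTrinomial hgr hl).isRadical n p (Ideal.mem_span_singleton.mp hn)

end Trinomials

/-! ### Exponents excluded by rigidity -/

section Rigid

variable {K σ : Type*} [Finite σ] [Field K] [IsAlgClosed K] [CharZero K]
  {gr : σ → Fin 3} {l : σ → ℕ}

theorem eval_groupedTrinomial [Fintype σ] (x : σ → K) :
    eval x (groupedTrinomial K gr l) = ∑ i, ∏ s, x s ^ groupExponent gr l i s := by
  rw [groupedTrinomial, map_sum]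
  refine Finset.sum_congr rfl fun i _ => ?_
  rw [eval_monomial, one_mul, Finsupp.prod_fintype _ _ fun _ => pow_zero _]

/-- An exponent 1 at `s` allows the Jacobian derivation in `X s` and `X t`, with `t` in another
group. It kills `f`, and it is locally nilpotent in triangular fashion: `pderiv s f` involves
neither `X s` nor `X t`, and `pderiv t f` does not involve `X s`. -/
theorem two_le_of_isRigidVariety (hgr : gr.Surjective) (hl : ∀ s, 0 < l s)
    (hrigid : IsRigidVariety (hypersurface (groupedTrinomial K gr l))) (s : σ) : 2 ≤ l s := by
  classical
  have := Fintype.ofFinite σ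
  by_contra hlt
  have hs1 : l s = 1 := by have := hl s; omega
  obtain ⟨t, ht⟩ : ∃ t, gr t ≠ gr s := by
    obtain ⟨j, hj⟩ := exists_ne (gr s)
    obtain ⟨t, rfl⟩ := hgr j
    exact ⟨t, hj⟩
  have hts : t ≠ s := fun h => ht (congrArg gr h)
  set f := groupedTrinomial K gr l with hf
  set D : Derivation K (MvPolynomial σ K) (MvPolynomial σ K) := mkDerivation K fun v =>
    if v = s then -pderiv t f else if v = t then pderiv s f else 0 with hD
  have hDs : D (X s) = -pderiv t f := by simp [hD, mkDerivation_X]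
  have hDt : D (X t) = pderiv s f := by simp [hD, mkDerivation_X, hts]
  have hDv : ∀ v, v ≠ s → v ≠ t → D (X v) = 0 := fun v h1 h2 => by
    simp [hD, mkDerivation_X, h1, h2]
  have hDf : D f = 0 := by
    rw [derivation_eq_sum_pderiv, Finset.sum_eq_add s t hts.symm]
    · rw [hDs, hDt]
      ring
    · rintro v _ ⟨h1, h2⟩
      rw [hDv v h1 h2, mul_zero]
    · simp
    · simp
  have hmon : ∀ u v : σ, (groupExponent gr l (gr u) - Finsupp.single u 1 : σ →₀ ℕ) v ≠ 0 →
      gr v = gr u ∧ (v = u → l u ≠ 1) := by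
    intro u v h
    rw [Finsupp.tsub_apply, groupExponent_apply] at h
    constructor
    · by_contra hne
      simp [hne] at h
    · rintro rfl h1
      simp [h1] at h
  have h1 : D (pderiv s f) = 0 := by
    rw [pderiv_groupedTrinomial]
    refine derivation_monomial_eq_zero (fun v hv => ?_) _
    obtain ⟨h1, h2⟩ := hmon s v hv
    exact hDv v (fun h => h2 h hs1) (by rintro rfl; exact ht h1)
  have h2 : X t ∈ locallyNilpotentSubalgebra D := by
    refine mem_locallyNilpotentSubalgebra_of_derivation ?_
    rw [hDt]
    exact ⟨1, h1⟩
  have h3 : ∀ v, v ≠ s → X v ∈ locallyNilpotentSubalgebra D := by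
    intro v hv
    by_cases hvt : v = t
    · exact hvt ▸ h2
    · exact ⟨1, hDv v hv hvt⟩
  have h4 : X s ∈ locallyNilpotentSubalgebra D := by
    refine mem_locallyNilpotentSubalgebra_of_derivation ?_
    rw [hDs, pderiv_groupedTrinomial]
    refine Subalgebra.neg_mem _ (monomial_mem_subalgebra (fun v hv => h3 v ?_) _)
    rintro rfl
    exact ht (hmon t v hv).1.symm
  have key := hrigid.dvd_derivation (dvd_of_eval_eq_zero hgr hl) (D := D)
    (by rw [hDf]; exact dvd_zero _) (fun v => by
      obtain ⟨n, hn⟩ : X v ∈ locallyNilpotentSubalgebra D := by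
        by_cases hv : v = s
        · exact hv ▸ h4
        · exact h3 v hv
      exact ⟨n, by rw [hn]; exact dvd_zero _⟩) t
  rw [hDt] at key
  -- The monomial containing `X s` takes the value -2 here and the other two the value 1, so `f`
  -- vanishes, but `pderiv s f` equals 1.
  set x : σ → K := fun v => if v = s then -2 else 1 with hx
  have hpow : ∀ (a : σ →₀ ℕ), ∏ v, x v ^ a v = (-2) ^ a s := by
    intro a
    rw [Finset.prod_eq_single s]
    · simp [hx]
    · intro v _ hv
      simp [hx, hv]
    · simp
  have hxf : x ∈ hypersurface f := by
    change eval x f = 0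
    rw [hf, eval_groupedTrinomial]
    rw [Finset.sum_congr rfl fun i _ => hpow (groupExponent gr l i)]
    simp only [groupExponent_apply]
    have : ∀ i : Fin 3, (∑ j, (-2 : K) ^ (if i = j then 1 else 0)) = 0 := by
      intro i
      fin_cases i <;> simp [Fin.sum_univ_three] <;> norm_num
    simpa only [hs1] using this (gr s)
  have := eval_eq_zero_of_dvd key hxf
  rw [hf, pderiv_groupedTrinomial, eval_monomial, Finsupp.prod_fintype _ _ fun _ => pow_zero _,
    hpow, Finsupp.tsub_apply, groupExponent_apply] at this
  simp [hs1] at this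

/-- Two monomials `X s ^ 2 + X t ^ 2` factor as `(X s + ι X t) (X s - ι X t)`, giving a
Danielewski-type equation. The derivation below kills `f` and the first factor `w`; it raises `X u`
to a multiple of `w` and `X s`, `X t` to multiples of `pderiv u f`. -/
theorem not_two_singletons_of_isRigidVariety (hgr : gr.Surjective) (hl : ∀ s, 0 < l s)
    (hrigid : IsRigidVariety (hypersurface (groupedTrinomial K gr l))) {s t : σ}
    (hst : gr s ≠ gr t) (hs : ∀ v, gr v = gr s → v = s) (ht : ∀ v, gr v = gr t → v = t)
    (hls : l s = 2) (hlt : l t = 2) : False := by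
  classical
  have := Fintype.ofFinite σ
  obtain ⟨u, hus, hut⟩ : ∃ u, gr u ≠ gr s ∧ gr u ≠ gr t := by
    have : ∀ a b : Fin 3, ∃ j, j ≠ a ∧ j ≠ b := by decide
    obtain ⟨j, h1, h2⟩ := this (gr s) (gr t)
    obtain ⟨u, rfl⟩ := hgr j
    exact ⟨u, h1, h2⟩
  have hst' : s ≠ t := fun h => hst (congrArg gr h)
  have hus' : u ≠ s := fun h => hus (congrArg gr h)
  have hut' : u ≠ t := fun h => hut (congrArg gr h)
  obtain ⟨ι, hι⟩ := IsAlgClosed.exists_pow_nat_eq (-1 : K) (n := 2) two_pos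
  set f := groupedTrinomial K gr l with hf
  set w : MvPolynomial σ K := X s + C ι * X t with hw
  set D : Derivation K (MvPolynomial σ K) (MvPolynomial σ K) := mkDerivation K fun v =>
    if v = s then -pderiv u f else if v = t then -C ι * pderiv u f else
      if v = u then C 2 * w else 0 with hD
  have hDs : D (X s) = -pderiv u f := by simp [hD, mkDerivation_X]
  have hDt : D (X t) = -C ι * pderiv u f := by simp [hD, mkDerivation_X, hst'.symm]
  have hDu : D (X u) = C 2 * w := by simp [hD, mkDerivation_X, hus', hut']
  have hDv : ∀ v, v ≠ s → v ≠ t → v ≠ u → D (X v) = 0 := fun v h1 h2 h3 => by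
    simp [hD, mkDerivation_X, h1, h2, h3]
  have hι' : (C ι : MvPolynomial σ K) ^ 2 = -1 := by rw [← map_pow, hι, map_neg, map_one]
  have hsingle : ∀ v, (∀ v', gr v' = gr v → v' = v) → l v = 2 →
      pderiv v f = C 2 * X v := by
    intro v hv hlv
    have hexp : groupExponent gr l (gr v) - Finsupp.single v 1 = Finsupp.single v 1 := ?_
    · rw [hf, pderiv_groupedTrinomial, C_mul_X_eq_monomial, hlv, hexp, Nat.cast_ofNat]
    ext v'
    rw [Finsupp.tsub_apply, groupExponent_apply, Finsupp.single_apply]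
    by_cases h : v' = v
    · simp [h, hlv]
    · rw [if_neg fun h' => h (hv v' h'), if_neg (Ne.symm h), tsub_zero]
  have hDf : D f = 0 := by
    rw [derivation_eq_sum_pderiv, ← Finset.sum_subset (Finset.subset_univ {s, t, u}),
      Finset.sum_insert (by simp [hst', hus'.symm]), Finset.sum_pair hut'.symm, hDs, hDt, hDu,
      hsingle s hs hls, hsingle t ht hlt, hw]
    · ring
    · intro v _ hv
      simp only [Finset.mem_insert, Finset.mem_singleton, not_or] at hv
      rw [hDv v hv.1 hv.2.1 hv.2.2, mul_zero]
  have hDw : D w = 0 := by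
    rw [hw, map_add, hDs, Derivation.leibniz, hDt, derivation_C, smul_zero, add_zero, smul_eq_mul]
    linear_combination (-pderiv u f) * hι'
  have h1 : ∀ v, v ≠ s → v ≠ t → X v ∈ locallyNilpotentSubalgebra D := by
    intro v h1 h2
    by_cases h3 : v = u
    · refine mem_locallyNilpotentSubalgebra_of_derivation ⟨1, ?_⟩
      rw [h3, hDu, Function.iterate_one, Derivation.leibniz, hDw, derivation_C, smul_zero,
        smul_zero, add_zero]
    · exact ⟨1, hDv v h1 h2 h3⟩
  have h2 : pderiv u f ∈ locallyNilpotentSubalgebra D := by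
    rw [hf, pderiv_groupedTrinomial]
    refine monomial_mem_subalgebra (fun v hv => ?_) _
    have hvu : gr v = gr u := by
      by_contra hne
      rw [Finsupp.tsub_apply, groupExponent_apply, if_neg hne, zero_tsub] at hv
      exact hv rfl
    exact h1 v (by rintro rfl; exact hus hvu.symm) (by rintro rfl; exact hut hvu.symm)
  have key := hrigid.dvd_derivation (dvd_of_eval_eq_zero hgr hl) (D := D)
    (by rw [hDf]; exact dvd_zero _) (fun v => by
      obtain ⟨n, hn⟩ : X v ∈ locallyNilpotentSubalgebra D := by
        by_cases hvs : v = s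
        · refine mem_locallyNilpotentSubalgebra_of_derivation ?_
          rw [hvs, hDs]
          exact Subalgebra.neg_mem _ h2
        by_cases hvt : v = t
        · refine mem_locallyNilpotentSubalgebra_of_derivation ?_
          rw [hvt, hDt, neg_mul]
          exact Subalgebra.neg_mem _ (Subalgebra.mul_mem _ (Subalgebra.algebraMap_mem _ ι) h2)
        · exact h1 v hvs hvt
      exact ⟨n, by rw [hn]; exact dvd_zero _⟩) u
  rw [hDu] at key
  -- Here the squares cancel and the third monomial is zero, whereas `w = 1 - ι ^ 2 = 2`.
  set x : σ → K := fun v => if v = s then 1 else if v = t then -ι else 0 with hx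
  have hxs : x s = 1 := by simp [hx]
  have hxt : x t = -ι := by simp [hx, hst'.symm]
  have hxf : x ∈ hypersurface f := by
    change eval x f = 0
    rw [hf, eval_groupedTrinomial]
    have e1 : ∀ v, (∀ v', gr v' = gr v → v' = v) → l v = 2 →
        ∏ v', x v' ^ groupExponent gr l (gr v) v' = x v ^ 2 := by
      intro v hv hlv
      rw [Finset.prod_eq_single v]
      · rw [groupExponent_apply, if_pos rfl, hlv]
      · intro v' _ hne
        rw [groupExponent_apply, if_neg fun h => hne (hv v' h), pow_zero]
      · simp
    have e2 : ∏ v', x v' ^ groupExponent gr l (gr u) v' = 0 := by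
      refine Finset.prod_eq_zero (Finset.mem_univ u) ?_
      rw [groupExponent_apply, if_pos rfl]
      simp [hx, hus', hut', (hl u).ne']
    have e3 : ∀ (F : Fin 3 → K) (a b c : Fin 3), a ≠ b → c ≠ a → c ≠ b →
        ∑ i, F i = F a + F b + F c := by
      intro F a b c hab hca hcb
      rw [Fin.sum_univ_three]
      fin_cases a <;> fin_cases b <;> fin_cases c <;> simp at hab hca hcb ⊢ <;> ring
    rw [e3 _ (gr s) (gr t) (gr u) hst hus hut, e1 s hs hls, e1 t ht hlt, e2, hxs, hxt]
    linear_combination hι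
  have := eval_eq_zero_of_dvd key hxf
  rw [hw, map_mul, map_add, map_mul, eval_C, eval_C, eval_X, eval_X, hxs, hxt] at this
  have h4 : (4 : K) = 0 := by linear_combination this + 2 * hι
  exact absurd h4 (by norm_num)

end Rigid

/-! ### Gradings compatible with a trinomial -/

section Weights

variable {σ : Type*} [Finite σ] {gr : σ → Fin 3} {l : σ → ℕ}

/-- Weights of the variables for which all three monomials of a trinomial have the same
weight. -/
def IsGroupedWeight {M : Type*} [AddCommMonoid M] (gr : σ → Fin 3) (l : σ → ℕ) (c : σ → M) :
    Prop :=
  ∀ i j, Finsupp.weight c (groupExponent gr l i) = Finsupp.weight c (groupExponent gr l j)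

theorem IsGroupedWeight.isWeightedHomogeneous {K M : Type*} [Field K] [AddCommMonoid M]
    {c : σ → M} (hc : IsGroupedWeight gr l c) :
    (groupedTrinomial K gr l).IsWeightedHomogeneous c
      (Finsupp.weight c (groupExponent gr l 0)) :=
  IsWeightedHomogeneous.sum _ _ _ fun i _ => isWeightedHomogeneous_monomial c _ _ (hc i 0)

theorem weight_add_apply {M : Type*} [AddCommMonoid M] (c c' : σ → M) (a : σ →₀ ℕ) :
    Finsupp.weight (c + c') a = Finsupp.weight c a + Finsupp.weight c' a := by
  simp [Finsupp.weight_apply, Finsupp.sum, Finset.sum_add_distrib]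

theorem weight_pi_single {M : Type*} [AddCommMonoid M] [DecidableEq σ] (u : σ) (r : M)
    (a : σ →₀ ℕ) : Finsupp.weight (Pi.single u r) a = a u • r := by
  have := Fintype.ofFinite σ
  rw [Finsupp.weight_apply,
    Finsupp.sum_fintype a (fun i n => n • (Pi.single u r : σ → M) i) fun _ => zero_smul _ _,
    Finset.sum_eq_single u]
  · rw [Pi.single_eq_same]
  · intro v _ hv
    rw [Pi.single_eq_of_ne hv, smul_zero]
  · simp

/-- A weight supported on two variables of the same group. -/
def pairWeight [DecidableEq σ] (l : σ → ℕ) (u v : σ) : σ → ℤ :=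
  Pi.single u (l v : ℤ) + Pi.single v (-l u : ℤ)

theorem weight_pairWeight [DecidableEq σ] (u v : σ) (a : σ →₀ ℕ) :
    Finsupp.weight (pairWeight l u v) a = a u * l v - a v * l u := by
  rw [pairWeight, weight_add_apply, weight_pi_single, weight_pi_single]
  simp
  ring

/-- All three monomials have weight zero. -/
theorem isGroupedWeight_pairWeight [DecidableEq σ] {u v : σ} (h : gr u = gr v) :
    IsGroupedWeight gr l (pairWeight l u v) := by
  have : ∀ i, Finsupp.weight (pairWeight l u v) (groupExponent gr l i) = 0 := by
    intro i
    rw [weight_pairWeight, groupExponent_apply, groupExponent_apply, h]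
    split_ifs <;> push_cast <;> ring
  intro i j
  rw [this, this]

/-- A weight supported on three variables of different groups. -/
def tripleWeight [DecidableEq σ] (l : σ → ℕ) (p q r : σ) : σ → ℤ :=
  Pi.single p (l q * l r : ℤ) + Pi.single q (l p * l r : ℤ) + Pi.single r (l p * l q : ℤ)

theorem weight_tripleWeight [DecidableEq σ] (p q r : σ) (a : σ →₀ ℕ) :
    Finsupp.weight (tripleWeight l p q r) a =
      a p * (l q * l r) + a q * (l p * l r) + a r * (l p * l q) := by
  rw [tripleWeight, weight_add_apply, weight_add_apply, weight_pi_single, weight_pi_single,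
    weight_pi_single]
  simp

theorem isGroupedWeight_tripleWeight [DecidableEq σ] {p q r : σ} (hpq : gr p ≠ gr q)
    (hpr : gr p ≠ gr r) (hqr : gr q ≠ gr r) : IsGroupedWeight gr l (tripleWeight l p q r) := by
  have : ∀ i, Finsupp.weight (tripleWeight l p q r) (groupExponent gr l i) =
      l p * l q * l r := by
    intro i
    rw [weight_tripleWeight, groupExponent_apply, groupExponent_apply, groupExponent_apply]
    have h3 : ∀ a b c i : Fin 3, a ≠ b → a ≠ c → b ≠ c → (i = a ∨ i = b ∨ i = c) := by decide
    rcases h3 _ _ _ i hpq hpr hqr with rfl | rfl | rfl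
    · simp [hpq.symm, hpr.symm]
      ring
    · simp [hpq, hqr.symm]
      ring
    · simp [hpr, hqr]
      ring
  intro i j
  rw [this, this]

theorem exists_third_group (hgr : gr.Surjective) (p q : σ) : ∃ r, gr p ≠ gr r ∧ gr q ≠ gr r := by
  have : ∀ a b : Fin 3, ∃ j, a ≠ j ∧ b ≠ j := by decide
  obtain ⟨j, h⟩ := this (gr p) (gr q)
  obtain ⟨r, rfl⟩ := hgr j
  exact ⟨r, h⟩

theorem exists_transversal (hgr : gr.Surjective) (p : σ) :
    ∃ q r, gr p ≠ gr q ∧ gr p ≠ gr r ∧ gr q ≠ gr r := by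
  obtain ⟨q, hq, -⟩ := exists_third_group hgr p p
  obtain ⟨r, hr, hr'⟩ := exists_third_group hgr p q
  exact ⟨q, r, hq, hr, hr'⟩

/-- The triple weight through `p` is nonnegative on all variables and positive at `p`, so it detects
`a p`. -/
theorem eq_zero_of_weight_eq_zero (hgr : gr.Surjective) (hl : ∀ s, 0 < l s) {a : σ →₀ ℕ}
    (ha : ∀ c : σ → ℤ, IsGroupedWeight gr l c → Finsupp.weight c a = 0) : a = 0 := by
  classical
  ext p
  obtain ⟨q, r, hpq, hpr, hqr⟩ := exists_transversal hgr p
  have h := ha _ (isGroupedWeight_tripleWeight hpq hpr hqr)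
  rw [weight_tripleWeight] at h
  have h' : a p * (l q * l r) = 0 := by
    have : a p * (l q * l r) + a q * (l p * l r) + a r * (l p * l q) = 0 := by exact_mod_cast h
    omega
  simpa [(hl q).ne', (hl r).ne'] using h'

/-- If `X s` divides the monomial, the quotient has weight zero for all gradings. Otherwise a pair
weight negative at `s` rules out companions of `s`, and triple weights through `s` and `u` bound `a
u`. -/
theorem eq_single_or_of_weight_eq (hgr : gr.Surjective) (hl : ∀ s, 0 < l s) {a : σ →₀ ℕ} {s : σ}
    (ha : ∀ c : σ → ℤ, IsGroupedWeight gr l c → Finsupp.weight c a = c s) :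
    a = Finsupp.single s 1 ∨ ((∀ v, gr v = gr s → v = s) ∧ a s = 0 ∧
      ∀ u, gr u ≠ gr s → a u * l s ≤ l u) := by
  classical
  have hle : 1 ≤ a s → a = Finsupp.single s 1 := by
    intro h
    have h1 : Finsupp.single s 1 ≤ a := Finsupp.single_le_iff.mpr h
    have h2 : a - Finsupp.single s 1 = 0 := by
      refine eq_zero_of_weight_eq_zero hgr hl fun c hc => ?_
      have h3 := ha c hc
      rw [← tsub_add_cancel_of_le h1, map_add, Finsupp.weight_single, one_smul] at h3
      linarith
    exact le_antisymm (tsub_eq_zero_iff_le.mp h2) h1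
  by_cases hs : a s = 0
  swap
  · exact Or.inl (hle (Nat.one_le_iff_ne_zero.mpr hs))
  refine Or.inr ⟨fun v hv => ?_, hs, fun u hu => ?_⟩
  · by_contra hne
    have h := ha _ (isGroupedWeight_pairWeight hv)
    rw [weight_pairWeight, hs, pairWeight, Pi.add_apply, Pi.single_eq_same,
      Pi.single_eq_of_ne (Ne.symm hne)] at h
    have h1 := hl v
    have h2 : (0 : ℤ) ≤ a v * l s := by positivity
    push_cast at h
    omega
  · obtain ⟨r, hr, hr'⟩ := exists_third_group hgr s u
    have h := ha _ (isGroupedWeight_tripleWeight hu.symm hr hr')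
    have hus : s ≠ u := fun h => hu (congrArg gr h.symm)
    have hrs : s ≠ r := fun h => hr (congrArg gr h)
    rw [weight_tripleWeight, hs, tripleWeight, Pi.add_apply, Pi.add_apply, Pi.single_eq_same,
      Pi.single_eq_of_ne hus, Pi.single_eq_of_ne hrs] at h
    have h' : a u * (l s * l r) + a r * (l s * l u) = l u * l r := by
      zify
      simpa only [Nat.cast_zero, zero_mul, zero_add, add_zero] using h
    have hlr := hl r
    refine Nat.le_of_mul_le_mul_right (c := l r) ?_ hlr
    calc a u * l s * l r = a u * (l s * l r) := by ring
      _ ≤ l u * l r := by omega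

end Weights

/-! ### Diagonalizable derivations on a rigid trinomial hypersurface are diagonal -/

section Diagonal

variable {K σ : Type*} [Field K]

theorem diagonal_derivation_monomial [Finite σ]
    {D : Derivation K (MvPolynomial σ K) (MvPolynomial σ K)}
    {c : σ → K} (hD : ∀ s, D (X s) = C (c s) * X s) (a : σ →₀ ℕ) (r : K) :
    D (monomial a r) = Finsupp.weight c a • monomial a r := by
  have := Fintype.ofFinite σ
  rw [derivation_eq_sum_pderiv, Finsupp.weight_apply,
    Finsupp.sum_fintype a (fun i n => n • c i) fun _ => zero_smul _ _, Finset.sum_smul]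
  refine Finset.sum_congr rfl fun s _ => ?_
  rw [pderiv_monomial, hD, C_mul_X_eq_monomial, monomial_mul, smul_monomial]
  by_cases h : a s = 0
  · simp [h]
  · rw [tsub_add_cancel_of_le (Finsupp.single_le_iff.mpr (Nat.one_le_iff_ne_zero.mpr h))]
    congr 1
    simp
    ring

theorem dvd_sub_weightedHomogeneousComponent {M : Type*} [AddCommGroup M] {w : σ → M}
    {f p : MvPolynomial σ K} {n : M}
    (h : ∀ m, m ≠ n → f ∣ weightedHomogeneousComponent w m p) :
    f ∣ p - weightedHomogeneousComponent w n p := by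
  set q := p - weightedHomogeneousComponent w n p with hq
  have hn := weightedHomogeneousComponent_isWeightedHomogeneous (w := w) n p
  rw [← finsum_weightedHomogeneousComponent w q]
  refine finsum_induction (fun x => f ∣ x) (dvd_zero f) (fun _ _ => dvd_add) fun m => ?_
  rw [hq, map_sub]
  by_cases hm : m = n
  · rw [hm, weightedHomogeneousComponent_eq_self hn, sub_self]
    exact dvd_zero f
  · rw [hn.weightedHomogeneousComponent_ne m hm, sub_zero]
    exact h m hm

variable [Finite σ] [IsAlgClosed K] [CharZero K] {gr : σ → Fin 3} {l : σ → ℕ}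

theorem weight_pi_apply {ι : Type*} (w : σ → ι → ℤ) (a : σ →₀ ℕ) (c : ι) :
    Finsupp.weight w a c = Finsupp.weight (fun s => w s c) a := by
  simp [Finsupp.weight_apply, Finsupp.sum]

/-- The universal weight of a trinomial. -/
def universalWeight (gr : σ → Fin 3) (l : σ → ℕ) (s : σ) :
    {c : σ → ℤ // IsGroupedWeight gr l c} → ℤ :=
  fun c => c.1 s

theorem isGroupedWeight_universalWeight (gr : σ → Fin 3) (l : σ → ℕ) :
    IsGroupedWeight gr l (universalWeight gr l) := by
  intro i j
  ext c
  rw [weight_pi_apply, weight_pi_apply]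
  exact c.2 i j

/-- A universal degree other than that of `X s` differs from it in some coordinate `c`; the
corresponding component is part of a nonzero-shift component for the integer grading `c`, which `f`
divides. -/
theorem dvd_sub_universalWeight_component (hgr : gr.Surjective) (hl : ∀ s, 0 < l s)
    (hrigid : IsRigidVariety (hypersurface (groupedTrinomial K gr l)))
    {D : Derivation K (MvPolynomial σ K) (MvPolynomial σ K)}
    (hf : groupedTrinomial K gr l ∣ D (groupedTrinomial K gr l))
    (hD : DiagonalizableMod (groupedTrinomial K gr l) D) (s : σ) :
    groupedTrinomial K gr l ∣
      D (X s) - derivationComponent (universalWeight gr l) D 0 (X s) := by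
  rw [derivationComponent, mkDerivation_X, add_zero]
  refine dvd_sub_weightedHomogeneousComponent fun m hm => ?_
  obtain ⟨c, hc⟩ := Function.ne_iff.mp hm
  have h1 := dvd_nonzero_component hrigid (dvd_of_eval_eq_zero hgr hl)
    c.2.isWeightedHomogeneous hf hD s hc
  have h2 := dvd_weightedHomogeneousComponent
    (isGroupedWeight_universalWeight gr l).isWeightedHomogeneous h1 m
  convert h2 using 1
  classical
  ext a
  rw [coeff_weightedHomogeneousComponent, coeff_weightedHomogeneousComponent,
    coeff_weightedHomogeneousComponent]
  split_ifs with h3 h4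
  · rfl
  · exact absurd (by rw [← h3, weight_pi_apply]; rfl) h4
  · rfl

/-- In degree zero only the constant term of the cofactor survives, because 1 is the only monomial
of universal weight zero. -/
theorem exists_smul_of_dvd_universalWeight (hgr : gr.Surjective) (hl : ∀ s, 0 < l s)
    {D : Derivation K (MvPolynomial σ K) (MvPolynomial σ K)}
    (hf : groupedTrinomial K gr l ∣ D (groupedTrinomial K gr l)) :
    ∃ r : K, derivationComponent (universalWeight gr l) D 0 (groupedTrinomial K gr l) =
      r • groupedTrinomial K gr l := by
  classical
  have hhom := (isGroupedWeight_universalWeight gr l).isWeightedHomogeneous (K := K)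
  obtain ⟨h, hh⟩ := hf
  rw [derivationComponent_of_isWeightedHomogeneous D hhom, hh,
    weightedHomogeneousComponent_mul hhom, add_zero, sub_self]
  refine ⟨coeff 0 h, ?_⟩
  have : weightedHomogeneousComponent (universalWeight gr l) 0 h = C (coeff 0 h) := by
    ext a
    rw [coeff_weightedHomogeneousComponent, coeff_C]
    by_cases ha : a = 0
    · rw [ha, map_zero, if_pos rfl, if_pos rfl]
    · rw [if_neg (Ne.symm ha), if_neg]
      intro h0
      refine ha (eq_zero_of_weight_eq_zero hgr hl fun c hc => ?_)
      have := congrFun h0 ⟨c, hc⟩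
      rwa [weight_pi_apply] at this
  rw [this, smul_eq_C_mul, mul_comm]

/-- An unwanted monomial `X^a` in `D' (X s)` forces `s` to be alone in its group and `a s = 0`. Its
contribution to `D' f = r • f` must be cancelled by one coming from another variable `t`, also alone
in its group. Comparing exponents forces `l s = l t = 2`, which rigidity forbids. -/
theorem universalWeight_component_support (hgr : gr.Surjective) (hl : ∀ s, 0 < l s)
    (hrigid : IsRigidVariety (hypersurface (groupedTrinomial K gr l)))
    {D : Derivation K (MvPolynomial σ K) (MvPolynomial σ K)}
    (hf : groupedTrinomial K gr l ∣ D (groupedTrinomial K gr l)) {s : σ} {a : σ →₀ ℕ}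
    (ha : coeff a (derivationComponent (universalWeight gr l) D 0 (X s)) ≠ 0) :
    a = Finsupp.single s 1 := by
  classical
  have := Fintype.ofFinite σ
  have h2 := two_le_of_isRigidVariety hgr hl hrigid
  obtain ⟨r, hr⟩ := exists_smul_of_dvd_universalWeight hgr hl hf
  set D' := derivationComponent (universalWeight gr l) D 0 with hD'
  have hdeg : ∀ {t : σ} {a : σ →₀ ℕ}, coeff a (D' (X t)) ≠ 0 →
      ∀ c : σ → ℤ, IsGroupedWeight gr l c → Finsupp.weight c a = c t := by
    intro t a ha c hc
    rw [hD', derivationComponent, mkDerivation_X, add_zero,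
      coeff_weightedHomogeneousComponent] at ha
    split_ifs at ha with h
    · have h := congrFun h ⟨c, hc⟩
      rwa [weight_pi_apply] at h
    · exact absurd rfl ha
  rcases eq_single_or_of_weight_eq hgr hl (hdeg ha) with h | ⟨hs1, has, hsu⟩
  · exact h
  exfalso
  have hexp : ∀ t v, (groupExponent gr l (gr t) - Finsupp.single t 1 : σ →₀ ℕ) v =
      if v = t then l t - 1 else if gr v = gr t then l v else 0 := by
    intro t v
    rw [Finsupp.tsub_apply, groupExponent_apply, Finsupp.single_apply]
    by_cases h : v = t
    · simp [h]
    · simp [h, Ne.symm h]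
  -- The exponent contributed by `X^a` to `pderiv s f * D' (X s)`. Its value `l s - 1` at `s` is
  -- neither 0 nor `l s`, so it is not an exponent of `f`.
  set b := (groupExponent gr l (gr s) - Finsupp.single s 1) + a with hb
  have hbs : b s = l s - 1 := by
    rw [hb, Finsupp.add_apply, hexp, if_pos rfl, has, add_zero]
  have hbL : ∀ i, b ≠ groupExponent gr l i := by
    intro i h
    have := DFunLike.congr_fun h s
    rw [hbs, groupExponent_apply] at this
    have := h2 s
    split_ifs at * <;> omega
  have hsum := congrArg (coeff b) hr
  rw [coeff_smul, coeff_groupedTrinomial_of_ne hbL, smul_zero, derivation_eq_sum_pderiv,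
    coeff_sum] at hsum
  have hls : (l s : K) ≠ 0 := by exact_mod_cast (hl s).ne'
  obtain ⟨t, hts, ht⟩ : ∃ t, t ≠ s ∧
      coeff b (pderiv t (groupedTrinomial K gr l) * D' (X t)) ≠ 0 := by
    by_contra! hcon
    rw [Finset.sum_eq_single s (fun t _ ht => hcon t ht) (by simp), pderiv_groupedTrinomial, hb,
      coeff_monomial_mul] at hsum
    exact (mul_ne_zero hls ha) hsum
  rw [pderiv_groupedTrinomial, coeff_monomial_mul'] at ht
  split_ifs at ht with hle
  swap
  · exact ht rfl
  set a' := b - (groupExponent gr l (gr t) - Finsupp.single t 1) with ha'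
  have hba' : b = (groupExponent gr l (gr t) - Finsupp.single t 1) + a' :=
    (add_tsub_cancel_of_le hle).symm
  rcases eq_single_or_of_weight_eq hgr hl (hdeg (right_ne_zero_of_mul ht)) with h | ⟨ht1, hat, htu⟩
  · refine hbL (gr t) ?_
    rw [hba', h, tsub_add_cancel_of_le]
    rw [Finsupp.single_le_iff, groupExponent_apply, if_pos rfl]
    exact hl t
  have hst : gr s ≠ gr t := fun h => hts (hs1 t h.symm)
  have e1 : a t = l t - 1 := by
    have := DFunLike.congr_fun hba' t
    rw [hb, Finsupp.add_apply, Finsupp.add_apply, hexp, hexp, hat, if_neg hts, if_neg hst.symm,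
      if_pos rfl] at this
    omega
  have e2 : a' s = l s - 1 := by
    have := DFunLike.congr_fun hba' s
    rw [hbs, Finsupp.add_apply, hexp, if_neg hts.symm, if_neg hst] at this
    omega
  have i1 := hsu t hst.symm
  have i2 := htu s hst
  rw [e1] at i1
  rw [e2] at i2
  -- With `l s = 2 + x` and `l t = 2 + y`, the inequality `(l t - 1) * l s ≤ l t` becomes `x + y + x
  -- * y ≤ 0`.
  obtain ⟨x, hx⟩ := Nat.exists_eq_add_of_le (h2 s)
  obtain ⟨y, hy⟩ := Nat.exists_eq_add_of_le (h2 t)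
  rw [hx, hy, show 2 + y - 1 = y + 1 by omega] at i1
  rw [hx, hy, show 2 + x - 1 = x + 1 by omega] at i2
  refine not_two_singletons_of_isRigidVariety hgr hl hrigid hst hs1 ht1 ?_ ?_
  · nlinarith
  · nlinarith

theorem exists_diagonal_of_isRigidVariety (hgr : gr.Surjective) (hl : ∀ s, 0 < l s)
    (hrigid : IsRigidVariety (hypersurface (groupedTrinomial K gr l)))
    {D : Derivation K (MvPolynomial σ K) (MvPolynomial σ K)}
    (hf : groupedTrinomial K gr l ∣ D (groupedTrinomial K gr l))
    (hD : DiagonalizableMod (groupedTrinomial K gr l) D) :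
    ∃ c : σ → K, IsGroupedWeight gr l c ∧
      ∀ s, groupedTrinomial K gr l ∣ D (X s) - C (c s) * X s := by
  classical
  obtain ⟨r, hr⟩ := exists_smul_of_dvd_universalWeight hgr hl hf
  have hdvd := dvd_sub_universalWeight_component hgr hl hrigid hf hD
  have hsupp := fun (s : σ) (a : σ →₀ ℕ) =>
    universalWeight_component_support hgr hl hrigid hf (s := s) (a := a)
  set D' := derivationComponent (universalWeight gr l) D 0
  have hX : ∀ s, D' (X s) = C (coeff (Finsupp.single s 1) (D' (X s))) * X s := by
    intro s
    ext a
    rw [C_mul_X_eq_monomial, coeff_monomial]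
    split_ifs with h
    · rw [h]
    · by_contra h0
      exact h (hsupp s a h0).symm
  refine ⟨fun s => coeff (Finsupp.single s 1) (D' (X s)), ?_, fun s => ?_⟩
  · have hi : ∀ i, Finsupp.weight (fun s => coeff (Finsupp.single s 1) (D' (X s)))
        (groupExponent gr l i) = r := by
      intro i
      have h := congrArg (coeff (groupExponent gr l i)) hr
      rw [coeff_smul, coeff_groupedTrinomial hgr hl, smul_eq_mul, mul_one, groupedTrinomial,
        map_sum, coeff_sum, Finset.sum_eq_single i] at h
      · rw [← h, diagonal_derivation_monomial hX, coeff_smul, coeff_monomial, if_pos rfl,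
          smul_eq_mul, mul_one]
      · intro j _ hj
        rw [diagonal_derivation_monomial hX, coeff_smul, coeff_monomial,
          if_neg fun h => hj (groupExponent_injective hgr hl h), smul_zero]
      · simp
    intro i j
    rw [hi, hi]
  · rw [← hX]
    exact hdvd s

end Diagonal

/-! ### Transfer of rigidity and derivations along an isomorphism -/

section Transfer

variable {K σ τ : Type*} [Field K]

/-- An isomorphism of the coordinate rings of two hypersurfaces, lifted to the polynomial
rings. -/
structure HypersurfaceEquiv (f : MvPolynomial σ K) (g : MvPolynomial τ K) where
  toHom : MvPolynomial τ K →ₐ[K] MvPolynomial σ K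
  invHom : MvPolynomial σ K →ₐ[K] MvPolynomial τ K
  dvd_toHom : ∀ p, g ∣ p → f ∣ toHom p
  dvd_invHom : ∀ p, f ∣ p → g ∣ invHom p
  toHom_invHom : ∀ p, f ∣ toHom (invHom p) - p
  invHom_toHom : ∀ p, g ∣ invHom (toHom p) - p

/-- The inverse isomorphism. -/
def HypersurfaceEquiv.symm {f : MvPolynomial σ K} {g : MvPolynomial τ K}
    (E : HypersurfaceEquiv f g) : HypersurfaceEquiv g f :=
  ⟨E.invHom, E.toHom, E.dvd_invHom, E.dvd_toHom, E.invHom_toHom, E.toHom_invHom⟩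

theorem eval_aeval_eq (x : σ → K) (P : τ → MvPolynomial σ K) (p : MvPolynomial τ K) :
    eval x (aeval P p) = eval (fun j => eval x (P j)) p := by
  have h : (aeval x).comp (aeval P) = aeval (R := K) fun j => eval x (P j) := by
    refine algHom_ext fun j => ?_
    rw [AlgHom.comp_apply, aeval_X, aeval_X, aeval_eq_eval]
  have := DFunLike.congr_fun h p
  rwa [AlgHom.comp_apply, aeval_eq_eval, aeval_eq_eval] at this

theorem nonempty_hypersurfaceEquiv {f : MvPolynomial σ K} {g : MvPolynomial τ K}
    (hf : ∀ p, (∀ x ∈ hypersurface f, eval x p = 0) → f ∣ p)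
    (hg : ∀ p, (∀ x ∈ hypersurface g, eval x p = 0) → g ∣ p)
    (h : AreIsomorphic (hypersurface f) (hypersurface g)) :
    Nonempty (HypersurfaceEquiv f g) := by
  obtain ⟨φ, ⟨P, hP⟩, ⟨Q, hQ⟩⟩ := h
  have eP : ∀ (x : hypersurface f) p, eval x.1 (aeval P p) = eval (φ x).1 p := by
    intro x p
    rw [eval_aeval_eq]
    congr 2
    exact funext fun j => (hP x j).symm
  have eQ : ∀ (y : hypersurface g) p, eval y.1 (aeval Q p) = eval (φ.symm y).1 p := by
    intro y p
    rw [eval_aeval_eq]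
    congr 2
    exact funext fun j => (hQ y j).symm
  have h0 : ∀ (x : hypersurface f) p, f ∣ p → eval x.1 p = 0 := by
    rintro x _ ⟨q, rfl⟩
    rw [map_mul, show eval x.1 f = 0 from x.2, zero_mul]
  have h0' : ∀ (x : hypersurface g) p, g ∣ p → eval x.1 p = 0 := by
    rintro x _ ⟨q, rfl⟩
    rw [map_mul, show eval x.1 g = 0 from x.2, zero_mul]
  refine ⟨⟨aeval P, aeval Q, fun p hp => hf _ fun x hx => ?_, fun p hp => hg _ fun x hx => ?_,
    fun p => hf _ fun x hx => ?_, fun p => hg _ fun x hx => ?_⟩⟩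
  · rw [eP ⟨x, hx⟩, h0' _ _ hp]
  · rw [eQ ⟨x, hx⟩, h0 _ _ hp]
  · rw [map_sub, eP ⟨x, hx⟩, eQ, Equiv.symm_apply_apply, sub_self]
  · rw [map_sub, eQ ⟨x, hx⟩, eP, Equiv.apply_symm_apply, sub_self]

theorem IsRigidVariety.of_areIsomorphic {V : Set (σ → K)} {W : Set (τ → K)}
    (hV : IsRigidVariety V) (h : AreIsomorphic V W) : IsRigidVariety W := by
  obtain ⟨φ, ⟨P, hP⟩, ⟨Q, hQ⟩⟩ := h
  intro inst ⟨R, hR⟩ t y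
  let _ : AddAction K V :=
    { vadd := fun t x => φ.symm (t +ᵥ φ x)
      zero_vadd := fun x => by
        change φ.symm ((0 : K) +ᵥ φ x) = x
        rw [zero_vadd, Equiv.symm_apply_apply]
      add_vadd := fun s t x => by
        change φ.symm ((s + t) +ᵥ φ x) = φ.symm (s +ᵥ φ (φ.symm (t +ᵥ φ x)))
        rw [add_vadd, Equiv.apply_symm_apply] }
  have hact : ∀ (t : K) (x : V), t +ᵥ x = φ.symm (t +ᵥ φ x) := fun _ _ => rfl
  have key := hV (by
    refine ⟨fun j => aeval (fun i => aeval
      (fun o : Option τ => o.elim (X none) fun k => rename some (P k)) (R i)) (Q j),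
      fun t x j => ?_⟩
    rw [hact, hQ, eval_aeval_eq]
    congr 2
    ext i
    rw [hR, eval_aeval_eq]
    congr 2
    ext o
    rcases o with _ | k
    · simp
    · simp only [Option.elim_some, eval_rename, Function.comp_def]
      exact hP x k) t (φ.symm y)
  rw [hact, Equiv.apply_symm_apply] at key
  exact φ.symm.injective key

namespace HypersurfaceEquiv

variable {f : MvPolynomial σ K} {g : MvPolynomial τ K} (E : HypersurfaceEquiv f g)

/-- The transfer of a derivation along an isomorphism of hypersurfaces. -/
noncomputable def transfer (D : Derivation K (MvPolynomial τ K) (MvPolynomial τ K)) :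
    Derivation K (MvPolynomial σ K) (MvPolynomial σ K) :=
  mkDerivation K fun s => E.toHom (D (E.invHom (X s)))

/-- The transfer is prescribed on variables only; modulo `f` it is conjugation by the isomorphism on
all polynomials, since both obey the Leibniz rule there. -/
theorem dvd_transfer_sub (D : Derivation K (MvPolynomial τ K) (MvPolynomial τ K))
    (p : MvPolynomial σ K) : f ∣ E.transfer D p - E.toHom (D (E.invHom p)) := by
  induction p using MvPolynomial.induction_on with
  | C a =>
    have h : E.invHom (C a) = C a := E.invHom.commutes a
    rw [h, derivation_C, derivation_C]
    simp
  | add p q hp hq =>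
    simp only [map_add, add_sub_add_comm]
    exact dvd_add hp hq
  | mul_X p s hp =>
    simp only [map_mul, Derivation.leibniz, smul_eq_mul, map_add]
    rw [show E.transfer D (X s) = E.toHom (D (E.invHom (X s))) from mkDerivation_X K _ s]
    obtain ⟨a, ha⟩ := hp
    obtain ⟨b, hb⟩ := E.toHom_invHom p
    obtain ⟨c, hc⟩ := E.toHom_invHom (X s)
    refine ⟨X s * a - b * E.toHom (D (E.invHom (X s))) - c * E.toHom (D (E.invHom p)), ?_⟩
    linear_combination X s * ha - E.toHom (D (E.invHom (X s))) * hb -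
      E.toHom (D (E.invHom p)) * hc

theorem dvd_transfer_self {D : Derivation K (MvPolynomial τ K) (MvPolynomial τ K)}
    (hD : g ∣ D g) : f ∣ E.transfer D f := by
  have h1 := E.dvd_transfer_sub D f
  have h2 := E.dvd_toHom _ (dvd_derivation_of_dvd hD (E.dvd_invHom f dvd_rfl))
  exact (dvd_sub_left h2).mp h1

theorem dvd_transfer_toHom {D : Derivation K (MvPolynomial τ K) (MvPolynomial τ K)}
    (hD : g ∣ D g) (q : MvPolynomial τ K) :
    f ∣ E.transfer D (E.toHom q) - E.toHom (D q) := by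
  have h1 := E.dvd_transfer_sub D (E.toHom q)
  have h2 := E.dvd_toHom _ (dvd_derivation_of_dvd hD (E.invHom_toHom q))
  rw [map_sub, map_sub] at h2
  have := dvd_add h1 h2
  rwa [sub_add_sub_cancel] at this

/-- Eigenvectors go to eigenvectors, and `p` differs from `E.toHom (E.invHom p)` by a multiple of
`f`, an eigenvector with eigenvalue 0 modulo `f`. -/
theorem diagonalizableMod_transfer {D : Derivation K (MvPolynomial τ K) (MvPolynomial τ K)}
    (hD : g ∣ D g) (hdiag : DiagonalizableMod g D) : DiagonalizableMod f (E.transfer D) := by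
  refine eq_top_iff.mpr fun p _ => ?_
  have h1 : ∀ q, E.toHom q ∈
      Submodule.span K {q | ∃ μ : K, f ∣ E.transfer D q - μ • q} := by
    intro q
    have hq : q ∈ Submodule.span K {q | ∃ μ : K, g ∣ D q - μ • q} := by
      rw [show Submodule.span K _ = ⊤ from hdiag]
      trivial
    induction hq using Submodule.span_induction with
    | mem q hq =>
      obtain ⟨μ, hμ⟩ := hq
      refine Submodule.subset_span ⟨μ, ?_⟩
      have h2 := dvd_add (E.dvd_transfer_toHom hD q) (E.dvd_toHom _ hμ)
      rwa [map_sub, map_smul, sub_add_sub_cancel] at h2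
    | zero =>
      rw [map_zero]
      exact Submodule.zero_mem _
    | add p q _ _ hp hq =>
      rw [map_add]
      exact Submodule.add_mem _ hp hq
    | smul c q _ hq =>
      rw [map_smul]
      exact Submodule.smul_mem _ c hq
  have h2 : E.toHom (E.invHom p) - p ∈
      Submodule.span K {q | ∃ μ : K, f ∣ E.transfer D q - μ • q} := by
    refine Submodule.subset_span ⟨0, ?_⟩
    rw [zero_smul, sub_zero]
    exact dvd_derivation_of_dvd (E.dvd_transfer_self hD) (E.toHom_invHom p)
  have := Submodule.sub_mem _ (h1 (E.invHom p)) h2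
  rwa [sub_sub_cancel] at this

end HypersurfaceEquiv

end Transfer

/-! ### Invariance of the multiplicity at the origin -/

section Order

variable {K σ τ : Type*} [Field K]

theorem AlgHom.map_idealOfVars_pow_le {Φ : MvPolynomial τ K →ₐ[K] MvPolynomial σ K}
    (hΦ : ∀ s, Φ (X s) ∈ idealOfVars σ K) {k : ℕ} {p : MvPolynomial τ K}
    (hp : p ∈ idealOfVars τ K ^ k) : Φ p ∈ idealOfVars σ K ^ k := by
  have h : idealOfVars τ K ≤ (idealOfVars σ K).comap Φ := by
    rw [Ideal.span_le]
    rintro _ ⟨s, rfl⟩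
    exact hΦ s
  exact Ideal.le_comap_pow Φ k (Ideal.pow_right_mono h k hp)

/-- On `m ^ 2` the round trip differs from the identity by elements of `(g) * m`, not merely of
`(g)`. As `g ∈ m ^ 2`, it follows that `g` lies in `m ^ k + g * m`, and a Nakayama-style induction
raises the power of `m` one step at a time. -/
theorem HypersurfaceEquiv.mem_idealOfVars_pow {f : MvPolynomial σ K} {g : MvPolynomial τ K}
    (E : HypersurfaceEquiv f g) (hto : ∀ s, E.toHom (X s) ∈ idealOfVars σ K)
    (hinv : ∀ s, E.invHom (X s) ∈ idealOfVars τ K) (hg : g ∈ idealOfVars τ K ^ 2) {k : ℕ}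
    (hf : f ∈ idealOfVars σ K ^ k) : g ∈ idealOfVars τ K ^ k := by
  set m := idealOfVars τ K with hm
  have h1 : ∀ p ∈ m, E.invHom (E.toHom p) ∈ m := by
    intro p hp
    rw [← pow_one m]
    refine AlgHom.map_idealOfVars_pow_le hinv (AlgHom.map_idealOfVars_pow_le hto ?_)
    rwa [pow_one]
  have h2 : ∀ p ∈ m * m, E.invHom (E.toHom p) - p ∈ Ideal.span {g} * m := by
    intro p hp
    induction hp using Submodule.mul_induction_on' with
    | mem_mul_mem p hp q hq =>
      have e : E.invHom (E.toHom (p * q)) - p * q =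
          (E.invHom (E.toHom q) - q) * E.invHom (E.toHom p) +
          (E.invHom (E.toHom p) - p) * q := by
        rw [map_mul, map_mul]
        ring
      rw [e]
      exact Ideal.add_mem _
        (Ideal.mul_mem_mul (Ideal.mem_span_singleton.mpr (E.invHom_toHom q)) (h1 p hp))
        (Ideal.mul_mem_mul (Ideal.mem_span_singleton.mpr (E.invHom_toHom p)) hq)
    | add p _ q _ hp hq =>
      rw [map_add, map_add, add_sub_add_comm]
      exact Ideal.add_mem _ hp hq
  have h3 : E.invHom (E.toHom g) ∈ m ^ k := by
    refine AlgHom.map_idealOfVars_pow_le hinv ?_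
    exact Ideal.mem_of_dvd _ (E.dvd_toHom g dvd_rfl) hf
  obtain ⟨z, hz, hgz⟩ := Ideal.mem_span_singleton_mul.mp (h2 g (by rwa [← pow_two]))
  have h4 : ∀ j, j ≤ k → g ∈ m ^ j := by
    intro j
    induction j with
    | zero => intro _; rw [pow_zero, Ideal.one_eq_top]; trivial
    | succ j ih =>
      intro hj
      have e : g = E.invHom (E.toHom g) - g * z := by rw [hgz, sub_sub_cancel]
      rw [e]
      refine Ideal.sub_mem _ (Ideal.pow_le_pow_right hj h3) ?_
      rw [pow_succ]
      exact Ideal.mul_mem_mul (ih (by omega)) hz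
  exact h4 k le_rfl

end Order

/-! ### Linear parts at the origin -/

section LinearPart

variable {K σ τ : Type*} [Field K]

theorem coeff_single_eq_constantCoeff_pderiv (p : MvPolynomial σ K) (u : σ) :
    coeff (Finsupp.single u 1) p = constantCoeff (pderiv u p) := by
  rw [constantCoeff_eq, coeff_pderiv]
  simp

theorem mem_idealOfVars_of_constantCoeff {p : MvPolynomial σ K} (h : constantCoeff p = 0) :
    p ∈ idealOfVars σ K := by
  rw [← pow_one (idealOfVars σ K), mem_pow_idealOfVars_iff']
  intro a ha
  rw [(Finsupp.degree_eq_zero_iff a).mp (by omega), ← constantCoeff_eq, h]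

/-- The chain rule at the origin, which `Φ` fixes. -/
theorem coeff_single_algHom [Fintype τ] {Φ : MvPolynomial τ K →ₐ[K] MvPolynomial σ K}
    (hΦ : ∀ s, constantCoeff (Φ (X s)) = 0) (p : MvPolynomial τ K) (u : σ) :
    coeff (Finsupp.single u 1) (Φ p) =
      ∑ t, coeff (Finsupp.single t 1) p * coeff (Finsupp.single u 1) (Φ (X t)) := by
  classical
  have hc : ∀ p, constantCoeff (Φ p) = constantCoeff p := by
    intro p
    induction p using MvPolynomial.induction_on with
    | C a => rw [show Φ (C a) = C a from Φ.commutes a, constantCoeff_C, constantCoeff_C]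
    | add p q hp hq => rw [map_add, map_add, map_add, hp, hq]
    | mul_X p s hp => rw [map_mul, map_mul, map_mul, hΦ, constantCoeff_X, mul_zero, mul_zero]
  simp only [coeff_single_eq_constantCoeff_pderiv]
  induction p using MvPolynomial.induction_on with
  | C a => rw [show Φ (C a) = C a from Φ.commutes a]; simp
  | add p q hp hq => simp only [map_add, hp, hq, add_mul, Finset.sum_add_distrib]
  | mul_X p s hp =>
    rw [map_mul, pderiv_mul, map_add, map_mul, map_mul, hΦ, mul_zero, zero_add, hc,
      Finset.sum_eq_single s]
    · rw [pderiv_mul, map_add, map_mul, map_mul, constantCoeff_X, mul_zero, zero_add,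
        pderiv_X_self, map_one, mul_one]
    · intro t _ ht
      rw [pderiv_mul, map_add, map_mul, map_mul, constantCoeff_X, mul_zero, zero_add,
        pderiv_X_of_ne ht.symm, map_zero, mul_zero, zero_mul]
    · simp

theorem coeff_eq_zero_of_dvd {f p : MvPolynomial σ K} (hf : f ∈ idealOfVars σ K ^ 2)
    (hfp : f ∣ p) {a : σ →₀ ℕ} (ha : a.degree < 2) : coeff a p = 0 :=
  (mem_pow_idealOfVars_iff' 2 p).mp (Ideal.mem_of_dvd _ hfp hf) a ha

theorem HypersurfaceEquiv.linearPart_mul [Fintype σ] [Fintype τ] [DecidableEq τ]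
    {f : MvPolynomial σ K} {g : MvPolynomial τ K} (E : HypersurfaceEquiv f g)
    (hinv : ∀ s, constantCoeff (E.invHom (X s)) = 0) (hg : g ∈ idealOfVars τ K ^ 2) :
    (Matrix.of fun (s : τ) (t : σ) => coeff (Finsupp.single t 1) (E.toHom (X s))) *
      (Matrix.of fun (t : σ) (s : τ) => coeff (Finsupp.single s 1) (E.invHom (X t))) = 1 := by
  ext s s'
  rw [Matrix.mul_apply]
  simp only [Matrix.of_apply]
  rw [← coeff_single_algHom hinv, Matrix.one_apply]
  have h := coeff_eq_zero_of_dvd hg (E.invHom_toHom (X s)) (a := Finsupp.single s' 1)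
    (by simp)
  rw [coeff_sub, sub_eq_zero] at h
  rw [h, coeff_X]
  refine if_congr ?_ rfl rfl
  rw [Finsupp.single_left_inj one_ne_zero]

/-- Some term in the permutation expansion of a nonzero determinant is nonzero. -/
theorem exists_equiv_forall_ne_zero [Fintype σ] [Fintype τ] [DecidableEq σ] [DecidableEq τ]
    {A : Matrix τ σ K} {B : Matrix σ τ K} (hAB : A * B = 1) (hBA : B * A = 1) :
    ∃ e : τ ≃ σ, ∀ s, A s (e s) ≠ 0 := by
  have hcard := Matrix.square_of_invertible A B hAB hBA
  obtain ⟨e₀⟩ : Nonempty (τ ≃ σ) := Fintype.card_eq.mp (by omega)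
  have hdet : (A.submatrix id e₀).det ≠ 0 := by
    have h : (A.submatrix id e₀) * (B.submatrix e₀ id) = 1 := by
      rw [Matrix.submatrix_mul_equiv, hAB, Matrix.submatrix_id_id]
    intro h0
    have := congrArg Matrix.det h
    rw [Matrix.det_mul, h0, zero_mul, Matrix.det_one] at this
    exact zero_ne_one this
  rw [Matrix.det_apply] at hdet
  obtain ⟨π, -, hπ⟩ := Finset.exists_ne_zero_of_sum_ne_zero hdet
  have hprod : ∏ s, A.submatrix id e₀ (π s) s ≠ 0 := fun h => hπ (by rw [h, smul_zero])
  refine ⟨π.symm.trans e₀, fun s => ?_⟩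
  have := Finset.prod_ne_zero_iff.mp hprod (π.symm s) (Finset.mem_univ _)
  simpa using this

end LinearPart

/-! ### Diagonal derivations -/

section DiagonalDerivation

variable {K σ : Type*} [Field K] [Finite σ]

/-- The derivation multiplying each variable by a scalar. -/
noncomputable def diagonalDerivation (c : σ → K) :
    Derivation K (MvPolynomial σ K) (MvPolynomial σ K) :=
  mkDerivation K fun s => C (c s) * X s

theorem diagonalDerivation_X (c : σ → K) (s : σ) :
    diagonalDerivation c (X s) = C (c s) * X s :=
  mkDerivation_X K _ s

theorem diagonalDerivation_monomial (c : σ → K) (a : σ →₀ ℕ) (r : K) :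
    diagonalDerivation c (monomial a r) = Finsupp.weight c a • monomial a r :=
  diagonal_derivation_monomial (diagonalDerivation_X c) a r

theorem coeff_diagonalDerivation (c : σ → K) (p : MvPolynomial σ K) (a : σ →₀ ℕ) :
    coeff a (diagonalDerivation c p) = Finsupp.weight c a * coeff a p := by
  classical
  induction p using MvPolynomial.induction_on' with
  | monomial b r =>
    rw [diagonalDerivation_monomial, coeff_smul, smul_eq_mul, coeff_monomial]
    split_ifs with h
    · rw [h]
    · rw [mul_zero, mul_zero]
  | add p q hp hq => rw [map_add, coeff_add, hp, hq, coeff_add, mul_add]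

theorem diagonalizableMod_diagonalDerivation (f : MvPolynomial σ K) (c : σ → K) :
    DiagonalizableMod f (diagonalDerivation c) := by
  refine eq_top_iff.mpr fun p _ => ?_
  rw [p.as_sum]
  refine Submodule.sum_mem _ fun a _ => Submodule.subset_span ⟨Finsupp.weight c a, ?_⟩
  rw [diagonalDerivation_monomial, sub_self]
  exact dvd_zero f

theorem IsGroupedWeight.dvd_diagonalDerivation {gr : σ → Fin 3} {l : σ → ℕ} {c : σ → K}
    (hc : IsGroupedWeight gr l c) :
    groupedTrinomial K gr l ∣ diagonalDerivation c (groupedTrinomial K gr l) := by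
  have : diagonalDerivation c (groupedTrinomial K gr l) =
      C (Finsupp.weight c (groupExponent gr l 0)) * groupedTrinomial K gr l := by
    rw [groupedTrinomial, map_sum, Finset.mul_sum]
    refine Finset.sum_congr rfl fun i _ => ?_
    rw [diagonalDerivation_monomial, hc i 0, smul_eq_C_mul]
  rw [this]
  exact dvd_mul_left _ _

theorem weight_intCast (c : σ → ℤ) (a : σ →₀ ℕ) :
    Finsupp.weight (fun s => (c s : K)) a = (Finsupp.weight c a : ℤ) := by
  simp [Finsupp.weight_apply, Finsupp.sum]

theorem isGroupedWeight_intCast_iff [CharZero K] {gr : σ → Fin 3} {l : σ → ℕ} {c : σ → ℤ} :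
    IsGroupedWeight gr l (fun s => (c s : K)) ↔ IsGroupedWeight gr l c :=
  forall₂_congr fun i j => by rw [weight_intCast, weight_intCast, Int.cast_inj]

end DiagonalDerivation

/-! ### Recovering a trinomial from its weights and its multiplicity -/

section Combinatorics

variable {σ τ : Type*} [Finite σ] [Finite τ]

theorem groupExponent_comp_equiv (gr : σ → Fin 3) (l : σ → ℕ) (e : τ ≃ σ) (i : Fin 3) :
    Finsupp.equivMapDomain e (groupExponent (gr ∘ e) (l ∘ e) i) = groupExponent gr l i := by
  ext s
  simp [Finsupp.equivMapDomain_apply, groupExponent_apply]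

theorem weight_equivMapDomain {M : Type*} [AddCommMonoid M] (c : σ → M) (e : τ ≃ σ)
    (a : τ →₀ ℕ) :
    Finsupp.weight c (Finsupp.equivMapDomain e a) = Finsupp.weight (c ∘ e) a := by
  rw [Finsupp.weight_apply, Finsupp.weight_apply, Finsupp.sum_equivMapDomain]
  rfl

theorem isGroupedWeight_comp_equiv {M : Type*} [AddCommMonoid M] {gr : σ → Fin 3} {l : σ → ℕ}
    {c : σ → M} (hc : IsGroupedWeight gr l c) (e : τ ≃ σ) :
    IsGroupedWeight (gr ∘ e) (l ∘ e) (c ∘ e) := by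
  intro i j
  rw [← weight_equivMapDomain, ← weight_equivMapDomain, groupExponent_comp_equiv,
    groupExponent_comp_equiv]
  exact hc i j

variable {gr₁ gr₂ : σ → Fin 3} {l₁ l₂ : σ → ℕ}

/-- If `u` and `v` lay in different groups of `gr₁`, the pair weight of the second trinomial would
give their monomials weights of opposite sign. -/
theorem group_eq_of_weights (h₁ : ∀ s, 0 < l₁ s) (h₂ : ∀ s, 0 < l₂ s)
    (h : ∀ c : σ → ℤ, IsGroupedWeight gr₂ l₂ c → IsGroupedWeight gr₁ l₁ c) {u v : σ}
    (huv : gr₂ u = gr₂ v) : gr₁ u = gr₁ v := by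
  classical
  by_contra hne
  have key := h _ (isGroupedWeight_pairWeight huv) (gr₁ u) (gr₁ v)
  simp only [weight_pairWeight, groupExponent_apply, if_neg hne, if_neg (Ne.symm hne),
    if_true] at key
  have e1 : (0 : ℤ) < l₁ u * l₂ v := by exact_mod_cast Nat.mul_pos (h₁ u) (h₂ v)
  have e2 : (0 : ℤ) < l₁ v * l₂ u := by exact_mod_cast Nat.mul_pos (h₁ v) (h₂ u)
  push_cast at key
  linarith

theorem exists_perm_of_weights (hgr₁ : gr₁.Surjective) (hgr₂ : gr₂.Surjective)
    (h₁ : ∀ s, 0 < l₁ s) (h₂ : ∀ s, 0 < l₂ s)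
    (h : ∀ c : σ → ℤ, IsGroupedWeight gr₂ l₂ c → IsGroupedWeight gr₁ l₁ c) :
    ∃ π : Equiv.Perm (Fin 3), ∀ s, gr₁ s = π (gr₂ s) := by
  choose x hx using hgr₂
  have hπ : ∀ s, gr₁ s = gr₁ (x (gr₂ s)) := fun s =>
    group_eq_of_weights h₁ h₂ h (hx _).symm
  have hsurj : Function.Surjective fun i => gr₁ (x i) := by
    intro j
    obtain ⟨s, rfl⟩ := hgr₁ j
    exact ⟨gr₂ s, (hπ s).symm⟩
  exact ⟨Equiv.ofBijective _ (Finite.surjective_iff_bijective.mp hsurj), hπ⟩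

/-- Pair weights compare exponents within a group, triple weights across groups. -/
theorem proportional_of_weights (hgr₁ : gr₁.Surjective) (hgr₂ : gr₂.Surjective)
    (h₁ : ∀ s, 0 < l₁ s) (h₂ : ∀ s, 0 < l₂ s)
    (h : ∀ c : σ → ℤ, IsGroupedWeight gr₂ l₂ c → IsGroupedWeight gr₁ l₁ c) (p q : σ) :
    l₁ p * l₂ q = l₁ q * l₂ p := by
  classical
  obtain ⟨π, hπ⟩ := exists_perm_of_weights hgr₁ hgr₂ h₁ h₂ h
  obtain ⟨r, hpr, hqr⟩ := exists_third_group hgr₂ p q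
  have hne : ∀ {u v}, gr₂ u ≠ gr₂ v → gr₁ u ≠ gr₁ v := by
    intro u v huv
    rw [hπ, hπ]
    exact fun h => huv (π.injective h)
  by_cases hpq : gr₂ p = gr₂ q
  · have hpq' := group_eq_of_weights h₁ h₂ h hpq
    have key := h _ (isGroupedWeight_pairWeight hpq) (gr₁ p) (gr₁ r)
    simp only [weight_pairWeight, groupExponent_apply, if_neg (hne hpr), if_neg (hne hqr),
      if_pos hpq'.symm, if_true] at key
    zify
    push_cast at key
    linarith
  · have key := h _ (isGroupedWeight_tripleWeight hpq hpr hqr) (gr₁ p) (gr₁ q)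
    simp only [weight_tripleWeight, groupExponent_apply, if_neg (hne hpq),
      if_neg (hne hpq).symm, if_neg (hne hpr).symm, if_neg (hne hqr).symm, if_true] at key
    refine Nat.eq_of_mul_eq_mul_right (h₂ r) ?_
    zify
    push_cast at key
    linarith

theorem degree_groupExponent [Fintype σ] (gr : σ → Fin 3) (l : σ → ℕ) (i : Fin 3) :
    (groupExponent gr l i).degree = ∑ s, if gr s = i then l s else 0 := by
  rw [Finsupp.degree_eq_sum]
  rfl

/-- Matching monomials have degrees in the same ratio as the exponents; this is applied to a
monomial of least degree in the second trinomial. -/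
theorem le_of_proportional (hgr₂ : gr₂.Surjective) (h₂ : ∀ s, 0 < l₂ s)
    {π : Equiv.Perm (Fin 3)} (hπ : ∀ s, gr₁ s = π (gr₂ s))
    (hprop : ∀ p q, l₁ p * l₂ q = l₁ q * l₂ p)
    (hdeg : ∀ k, (∀ i, k ≤ (groupExponent gr₂ l₂ i).degree) →
      ∀ i, k ≤ (groupExponent gr₁ l₁ i).degree) (t : σ) : l₂ t ≤ l₁ t := by
  have := Fintype.ofFinite σ
  obtain ⟨i, hi⟩ := Finite.exists_min fun i => (groupExponent gr₂ l₂ i).degree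
  have h1 := hdeg _ hi (π i)
  have h2 : (groupExponent gr₁ l₁ (π i)).degree * l₂ t =
      l₁ t * (groupExponent gr₂ l₂ i).degree := by
    rw [degree_groupExponent, degree_groupExponent, Finset.sum_mul, Finset.mul_sum]
    refine Finset.sum_congr rfl fun s _ => ?_
    rw [hπ s]
    by_cases h : gr₂ s = i
    · rw [if_pos h, if_pos (congrArg π h), hprop]
    · rw [if_neg h, if_neg fun h' => h (π.injective h'), zero_mul, mul_zero]
  have h3 : 0 < (groupExponent gr₂ l₂ i).degree := by
    obtain ⟨s, rfl⟩ := hgr₂ i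
    rw [degree_groupExponent]
    refine Finset.sum_pos' (fun _ _ => Nat.zero_le _) ⟨s, Finset.mem_univ s, ?_⟩
    rw [if_pos rfl]
    exact h₂ s
  refine Nat.le_of_mul_le_mul_right (c := (groupExponent gr₂ l₂ i).degree) ?_ h3
  rw [← h2, mul_comm]
  exact Nat.mul_le_mul_right _ h1

theorem groupedTrinomial_mem_idealOfVars_pow_iff {K : Type*} [Field K] {gr : σ → Fin 3}
    {l : σ → ℕ} (hgr : gr.Surjective) (hl : ∀ s, 0 < l s) (k : ℕ) :
    groupedTrinomial K gr l ∈ idealOfVars σ K ^ k ↔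
      ∀ i, k ≤ (groupExponent gr l i).degree := by
  constructor
  · intro h i
    refine (mem_pow_idealOfVars_iff k _).mp h _ (mem_support_iff.mpr ?_)
    rw [coeff_groupedTrinomial hgr hl]
    exact one_ne_zero
  · intro h
    exact Ideal.sum_mem _ fun i _ => (monomial_mem_pow_idealOfVars_iff k _ one_ne_zero).mpr (h i)

theorem two_le_degree_groupExponent {gr : σ → Fin 3} {l : σ → ℕ} (hgr : gr.Surjective)
    (hl : ∀ s, 2 ≤ l s) (i : Fin 3) : 2 ≤ (groupExponent gr l i).degree := by
  obtain ⟨s, rfl⟩ := hgr i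
  refine (hl s).trans ?_
  have := Finsupp.le_degree s (groupExponent gr l (gr s))
  rwa [groupExponent_apply, if_pos rfl] at this

theorem rename_groupedTrinomial {K : Type*} [Field K] (gr : σ → Fin 3) (l : σ → ℕ)
    (e : τ ≃ σ) : rename e (groupedTrinomial K (gr ∘ e) (l ∘ e)) = groupedTrinomial K gr l := by
  rw [groupedTrinomial, groupedTrinomial, map_sum]
  refine Finset.sum_congr rfl fun i _ => ?_
  rw [rename_monomial, ← Finsupp.equivMapDomain_eq_mapDomain, groupExponent_comp_equiv]

theorem groupedTrinomial_perm {K : Type*} [Field K] {π : Equiv.Perm (Fin 3)}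
    (hπ : ∀ s, gr₁ s = π (gr₂ s)) (l : σ → ℕ) :
    groupedTrinomial K gr₁ l = groupedTrinomial K gr₂ l := by
  rw [groupedTrinomial, groupedTrinomial, ← Equiv.sum_comp π]
  refine Finset.sum_congr rfl fun i _ => ?_
  congr 2
  ext s
  rw [groupExponent_apply, groupExponent_apply, hπ s]
  exact if_congr π.apply_eq_iff_eq rfl rfl

end Combinatorics

/-! ### Isomorphic rigid trinomial hypersurfaces -/

section Isomorphism

variable {K σ τ : Type*} [Field K] [IsAlgClosed K] [CharZero K] [Finite σ] [Finite τ]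
  {gr : σ → Fin 3} {l : σ → ℕ} {gr' : τ → Fin 3} {l' : τ → ℕ}

/-- The image of `X s` is an eigenvector, modulo `f`, of a derivation diagonal on both sides. As `f`
has no terms of degree below 2, the eigenvalue equation is exact on constant and linear
coefficients. -/
theorem HypersurfaceEquiv.exists_weight (hgr : gr.Surjective) (hl : ∀ s, 0 < l s)
    (hrigid : IsRigidVariety (hypersurface (groupedTrinomial K gr l)))
    (E : HypersurfaceEquiv (groupedTrinomial K gr l) (groupedTrinomial K gr' l'))
    {c : τ → K} (hc : IsGroupedWeight gr' l' c) :
    ∃ c' : σ → K, IsGroupedWeight gr l c' ∧ ∀ (s : τ) (a : σ →₀ ℕ), a.degree < 2 →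
      Finsupp.weight c' a * coeff a (E.toHom (X s)) = c s * coeff a (E.toHom (X s)) := by
  have hD := hc.dvd_diagonalDerivation
  obtain ⟨c', hc', hdvd⟩ := exists_diagonal_of_isRigidVariety hgr hl hrigid
    (E.dvd_transfer_self hD)
    (E.diagonalizableMod_transfer hD (diagonalizableMod_diagonalDerivation _ c))
  refine ⟨c', hc', fun s a ha => ?_⟩
  have h1 := dvd_derivation_sub_derivation (D := E.transfer (diagonalDerivation c)) (D' := diagonalDerivation c')
    (fun s => by rw [diagonalDerivation_X]; exact hdvd s) (E.toHom (X s))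
  have h2 := dvd_sub (E.dvd_transfer_toHom hD (X s)) h1
  rw [sub_sub_sub_cancel_left, diagonalDerivation_X, ← smul_eq_C_mul, map_smul] at h2
  have hf : groupedTrinomial K gr l ∈ idealOfVars σ K ^ 2 :=
    (groupedTrinomial_mem_idealOfVars_pow_iff hgr hl 2).mpr
      (two_le_degree_groupExponent hgr (two_le_of_isRigidVariety hgr hl hrigid))
  have h3 := coeff_eq_zero_of_dvd hf h2 ha
  rwa [coeff_sub, coeff_diagonalDerivation, coeff_smul, smul_eq_mul, sub_eq_zero] at h3

/-- Constants have weight zero, while a triple weight through `s` is nonzero at `s`. -/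
theorem HypersurfaceEquiv.constantCoeff_toHom (hgr : gr.Surjective) (hl : ∀ s, 0 < l s)
    (hgr' : gr'.Surjective) (hl' : ∀ s, 0 < l' s)
    (hrigid : IsRigidVariety (hypersurface (groupedTrinomial K gr l)))
    (E : HypersurfaceEquiv (groupedTrinomial K gr l) (groupedTrinomial K gr' l')) (s : τ) :
    constantCoeff (E.toHom (X s)) = 0 := by
  classical
  obtain ⟨q, r, hsq, hsr, hqr⟩ := exists_transversal hgr' s
  obtain ⟨c', -, h⟩ := E.exists_weight hgr hl hrigid
    (isGroupedWeight_intCast_iff.mpr (isGroupedWeight_tripleWeight (l := l') hsq hsr hqr))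
  have h0 := h s 0 (by simp)
  rw [map_zero, zero_mul, eq_comm] at h0
  refine (mul_eq_zero.mp h0).resolve_left ?_
  have hq : s ≠ q := fun h => hsq (congrArg gr' h)
  have hr : s ≠ r := fun h => hsr (congrArg gr' h)
  rw [tripleWeight, Pi.add_apply, Pi.add_apply, Pi.single_eq_same, Pi.single_eq_of_ne hq,
    Pi.single_eq_of_ne hr, add_zero, add_zero]
  exact_mod_cast (Nat.mul_pos (hl' q) (hl' r)).ne'

theorem HypersurfaceEquiv.exists_rename (hgr : gr.Surjective) (hl : ∀ s, 0 < l s)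
    (hgr' : gr'.Surjective) (hl' : ∀ s, 0 < l' s)
    (hrigid : IsRigidVariety (hypersurface (groupedTrinomial K gr l)))
    (hrigid' : IsRigidVariety (hypersurface (groupedTrinomial K gr' l')))
    (E : HypersurfaceEquiv (groupedTrinomial K gr l) (groupedTrinomial K gr' l')) :
    ∃ e : σ ≃ τ, rename e (groupedTrinomial K gr l) = groupedTrinomial K gr' l' := by
  classical
  have := Fintype.ofFinite σ
  have := Fintype.ofFinite τ
  have hf2 := (groupedTrinomial_mem_idealOfVars_pow_iff (K := K) hgr hl 2).mpr
    (two_le_degree_groupExponent hgr (two_le_of_isRigidVariety hgr hl hrigid))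
  have hg2 := (groupedTrinomial_mem_idealOfVars_pow_iff (K := K) hgr' hl' 2).mpr
    (two_le_degree_groupExponent hgr' (two_le_of_isRigidVariety hgr' hl' hrigid'))
  have hto := E.constantCoeff_toHom hgr hl hgr' hl' hrigid
  have hinv : ∀ s, constantCoeff (E.invHom (X s)) = 0 :=
    E.symm.constantCoeff_toHom hgr' hl' hgr hl hrigid'
  obtain ⟨e, he⟩ := exists_equiv_forall_ne_zero (E.linearPart_mul hinv hg2)
    (E.symm.linearPart_mul hto hf2)
  have hweight : ∀ c : τ → ℤ, IsGroupedWeight gr' l' c →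
      IsGroupedWeight (gr ∘ e) (l ∘ e) c := by
    intro c hc
    obtain ⟨c', hc', h⟩ := E.exists_weight hgr hl hrigid (isGroupedWeight_intCast_iff.mpr hc)
    -- The monomial `X (e s)` occurs in the image of `X s`, so the two eigenvalues coincide.
    have hce : c' ∘ e = fun s => (c s : K) := by
      funext s
      have h1 := h s (Finsupp.single (e s) 1) (by simp)
      rw [Finsupp.weight_single, one_smul] at h1
      exact mul_right_cancel₀ (he s) h1
    rw [← isGroupedWeight_intCast_iff (K := K), ← hce]
    exact isGroupedWeight_comp_equiv hc' e
  have hgr₁ : (gr ∘ e).Surjective := hgr.comp e.surjective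
  have hl₁ : ∀ s, 0 < (l ∘ e) s := fun s => hl (e s)
  obtain ⟨π, hπ⟩ := exists_perm_of_weights hgr₁ hgr' hl₁ hl' hweight
  have hprop := proportional_of_weights hgr₁ hgr' hl₁ hl' hweight
  have hdeg : ∀ i, (groupExponent gr l i).degree = (groupExponent (gr ∘ e) (l ∘ e) i).degree := by
    intro i
    rw [degree_groupExponent, degree_groupExponent, ← Equiv.sum_comp e]
    rfl
  have hord : ∀ k, (∀ i, k ≤ (groupExponent (gr ∘ e) (l ∘ e) i).degree) ↔
      ∀ i, k ≤ (groupExponent gr' l' i).degree := by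
    intro k
    simp only [← hdeg]
    rw [← groupedTrinomial_mem_idealOfVars_pow_iff (K := K) hgr hl,
      ← groupedTrinomial_mem_idealOfVars_pow_iff (K := K) hgr' hl']
    exact ⟨E.mem_idealOfVars_pow (fun s => mem_idealOfVars_of_constantCoeff (hto s))
        (fun s => mem_idealOfVars_of_constantCoeff (hinv s)) hg2,
      E.symm.mem_idealOfVars_pow (fun s => mem_idealOfVars_of_constantCoeff (hinv s))
        (fun s => mem_idealOfVars_of_constantCoeff (hto s)) hf2⟩
  have hll : l ∘ e = l' := by
    funext t
    refine le_antisymm ?_ ?_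
    · refine le_of_proportional hgr₁ hl₁ (π := π.symm) (fun s => ?_) (fun p q => ?_)
        (fun k => (hord k).mp) t
      · rw [hπ, Equiv.symm_apply_apply]
      · rw [mul_comm, ← hprop, mul_comm]
    · exact le_of_proportional hgr' hl' hπ hprop (fun k => (hord k).mpr) t
  refine ⟨e.symm, ?_⟩
  rw [← rename_groupedTrinomial gr l e, hll, rename_rename, Equiv.symm_comp_self, rename_id_apply]
  exact groupedTrinomial_perm hπ l'

theorem areIsomorphic_of_rename {f : MvPolynomial σ K} {g : MvPolynomial τ K} (e : σ ≃ τ)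
    (h : rename e f = g) : AreIsomorphic (hypersurface f) (hypersurface g) := by
  subst h
  refine ⟨⟨fun x => ⟨x.1 ∘ e.symm, ?_⟩, fun y => ⟨y.1 ∘ e, ?_⟩, fun x => ?_, fun y => ?_⟩,
    ⟨fun j => X (e.symm j), fun x j => ?_⟩, ⟨fun j => X (e j), fun x j => ?_⟩⟩
  · change eval _ (rename e f) = 0
    rw [eval_rename, Function.comp_assoc, Equiv.symm_comp_self]
    exact x.2
  · change eval _ f = 0
    rw [← eval_rename]
    exact y.2
  · exact Subtype.ext (by simp [Function.comp_assoc])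
  · exact Subtype.ext (by simp [Function.comp_assoc])
  · rw [eval_X]
    rfl
  · rw [eval_X]
    rfl

end Isomorphism

theorem trinomial_eq_groupedTrinomial {K : Type*} [Field K] {n : Fin 3 → ℕ}
    (l : (i : Fin 3) → Fin (n i) → ℕ) :
    trinomial K l = groupedTrinomial K Sigma.fst fun s => l s.1 s.2 := by
  rw [trinomial, groupedTrinomial]
  refine Finset.sum_congr rfl fun i _ => ?_
  rw [monomial_eq, C_1, one_mul, Finsupp.prod_fintype _ _ fun _ => pow_zero _, Fintype.prod_sigma,
    Finset.prod_eq_single i]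
  · refine Finset.prod_congr rfl fun j _ => ?_
    rw [groupExponent_apply, if_pos rfl]
  · intro k _ hk
    refine Finset.prod_eq_one fun j _ => ?_
    rw [groupExponent_apply, if_neg hk, pow_zero]
  · simp

theorem mainTheorem4 {K : Type*} [Field K] [IsAlgClosed K] [CharZero K]
    {n m : Fin 3 → ℕ} (hn : ∀ i, 0 < n i) (hm : ∀ i, 0 < m i)
    (l : (i : Fin 3) → Fin (n i) → ℕ) (l' : (i : Fin 3) → Fin (m i) → ℕ)
    (hl : ∀ i j, 0 < l i j) (hl' : ∀ i j, 0 < l' i j)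
    (hrigid : IsRigidVariety (hypersurface (trinomial K l))) :
    AreIsomorphic (hypersurface (trinomial K l)) (hypersurface (trinomial K l')) ↔
      ∃ e : ((i : Fin 3) × Fin (n i)) ≃ ((i : Fin 3) × Fin (m i)),
        MvPolynomial.rename e (trinomial K l) = trinomial K l' := by
  refine ⟨fun h => ?_, fun ⟨e, he⟩ => areIsomorphic_of_rename e he⟩
  -- Rigidity of the second hypersurface allows the argument at the origin to run in both
  -- directions.
  have hrigid' : IsRigidVariety (hypersurface (trinomial K l')) := hrigid.of_areIsomorphic h
  have hgr : Function.Surjective (Sigma.fst : (i : Fin 3) × Fin (n i) → Fin 3) :=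
    fun i => ⟨⟨i, ⟨0, hn i⟩⟩, rfl⟩
  have hgr' : Function.Surjective (Sigma.fst : (i : Fin 3) × Fin (m i) → Fin 3) :=
    fun i => ⟨⟨i, ⟨0, hm i⟩⟩, rfl⟩
  rw [trinomial_eq_groupedTrinomial] at hrigid hrigid'
  rw [trinomial_eq_groupedTrinomial, trinomial_eq_groupedTrinomial] at h ⊢
  obtain ⟨E⟩ := nonempty_hypersurfaceEquiv (dvd_of_eval_eq_zero hgr fun s => hl s.1 s.2)
    (dvd_of_eval_eq_zero hgr' fun s => hl' s.1 s.2) h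
  exact E.exists_rename hgr (fun s => hl s.1 s.2) hgr' (fun s => hl' s.1 s.2) hrigid hrigid'
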